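/- An \emph{ultragraph} $\mathcal G=(G^0,\mathcal G^1,r,s)$ consists of sets $G^0$ (vertices) and $\mathcal G^1$ (edges) and maps $s:\mathcal G^1\to G^0$ and $r:\mathcal G^1\to P(G^0)\setminus\{\emptyset\}$. Let $\mathcal G^0$ be the smallest subset of $P(G^0)$ that contains $\emptyset$, all $\{v\}$ with $v\in G^0$ and all $r(e)$ with $e\in\mathcal G^1$, and that is closed under finite unions and under finite nonempty intersections. A \emph{closed path} is a finite sequence of edges $\alpha=\alpha_1\cdots\alpha_n$, $n\ge 1$, with $s(\alpha_{i+1})\in r(\alpha_i)$ for $1\le i<n$ and $s(\alpha_1)\in r(\alpha_n)$. With the convention $\alpha_{n+1}=\alpha_1$, an \emph{exit} for $\alpha$ is either an edge $e$ such that $s(e)\in r(\alpha_i)$ and $e\ne\alpha_{i+1}$ for some $i\in\{1,\dots,n\}$, or a vertex $w$ with $s^{-1}(w)=\emptyset$ (a sink) such that $w\in r(\alpha_i)$ for some $i$. The ultragraph $\mathcal G$ satisfies \emph{Condition (L)} if every closed path has an exit. For a commutative unital ring $R$, the \emph{Leavitt path algebra} $L_R(\mathcal G)$ is the universal (not necessarily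 unital) associative $R$-algebra with generators $s_e,s_e^*$ $(e\in\mathcal G^1)$ and $p_A$ $(A\in\mathcal G^0)$ and relations, where $p_v=p_{\{v\}}$: (1) $p_\emptyset=0$, $p_Ap_B=p_{A\cap B}$ and $p_{A\cup B}=p_A+p_B-p_{A\cap B}$ for all $A,B\in\mathcal G^0$; (2) $p_{s(e)}s_e=s_ep_{r(e)}=s_e$ and $p_{r(e)}s_e^*=s_e^*p_{s(e)}=s_e^*$ for all $e$; (3) $s_e^*s_f=\delta_{e,f}\,p_{r(e)}$ for all $e,f$; (4) $p_v=\sum_{s(e)=v}s_es_e^*$ whenever $0<|s^{-1}(v)|<\infty$. A \emph{$\mathcal G$-algebraic branching system} on a set $X$ consists of subsets $R_e$ $(e\in\mathcal G^1)$ and $D_A$ $(A\in\mathcal G^0)$ of $X$ and bijections $f_e:D_{r(e)}\to R_e$ such that, writing $D_v=D_{\{v\}}$: $R_e\cap R_f=\emptyset$ for $e\neq f$; $D_\emptyset=\emptyset$, $D_A\cap D_B=D_{A\cap B}$ and $D_A\cup D_B=D_{A\cup B}$; $R_e\subseteq D_{s(e)}$; and $D_v=\bigcup_{e\in s^{-1}(v)}R_e$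 if $0<|s^{-1}(v)|<\infty$. Let $M$ be the $R$-module of all maps $X\to R$. The \emph{induced representation} is the $R$-algebra homomorphism $\pi:L_R(\mathcal G)\to\mathrm{Hom}_R(M)$ with $\pi(s_e)\phi=(\phi\circ f_e^{-1})\cdot 1_{R_e}$, $\pi(s_e^*)\phi=(\phi\circ f_e)\cdot 1_{D_{r(e)}}$ and $\pi(p_A)\phi=1_{D_A}\cdot\phi$. It is \emph{faithful} if it is injective. \textbf{Theorem.} Let $R$ be a nonzero commutative unital ring and let $\mathcal G$ be an ultragraph such that $s^{-1}(v)$ and $r(e)$ are finite or countable for all $v\in G^0$ and $e\in\mathcal G^1$. Then $\mathcal G$ satisfies Condition (L) if and only if, for every $\mathcal G$-algebraic branching system $\{R_e,D_A,f_e\}$ with $D_A\neq\emptyset$ for each $\emptyset\neq A\in\mathcal G^0$, the induced representation of $L_R(\mathcal G)$ is faithful. -/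

import Mathlib

universe u v w x

/-- An ultragraph with vertex set `V` and edge set `E`: every edge has a source vertex and a
nonempty set of vertices as its range. -/
structure Ultragraph (V : Type u) (E : Type v) where
  /-- The source map. -/
  s : E → V
  /-- The range map. -/
  r : E → Set V
  /-- Ranges are nonempty. -/
  r_nonempty : ∀ e, (r e).Nonempty

namespace Ultragraph

/-! ### Generalized vertices -/

section GenVertex

variable {V : Type u} {E : Type v}

/-- Membership in the smallest family of subsets of `V` that contains all singletons and all
ranges and that is closed under finite unions (the empty union included) and under intersections of
two of its members. -/
inductive IsGenVertex (G : Ultragraph V E) : Set V → Prop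
  | empty : IsGenVertex G ∅
  | singleton (v : V) : IsGenVertex G {v}
  | range (e : E) : IsGenVertex G (G.r e)
  | union {A B : Set V} : IsGenVertex G A → IsGenVertex G B → IsGenVertex G (A ∪ B)
  | inter {A B : Set V} : IsGenVertex G A → IsGenVertex G B → IsGenVertex G (A ∩ B)

/-- The type of generalized vertices of an ultragraph. -/
def GenVertex (G : Ultragraph V E) : Type u := {A : Set V // G.IsGenVertex A}

variable {G : Ultragraph V E}

/-- The underlying set of vertices of a generalized vertex. -/
def GenVertex.toSet (A : G.GenVertex) : Set V := A.1

instance : EmptyCollection G.GenVertex := ⟨⟨∅, .empty⟩⟩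

instance : Union G.GenVertex := ⟨fun A B => ⟨A.1 ∪ B.1, .union A.2 B.2⟩⟩

instance : Inter G.GenVertex := ⟨fun A B => ⟨A.1 ∩ B.1, .inter A.2 B.2⟩⟩

variable (G)

/-- The generalized vertex `{v}`. -/
def vert (v : V) : G.GenVertex := ⟨{v}, .singleton v⟩

/-- The generalized vertex `r(e)`. -/
def range (e : E) : G.GenVertex := ⟨G.r e, .range e⟩

end GenVertex

/-! ### Condition (L) -/

section ConditionL

variable {V : Type u} {E : Type v} (G : Ultragraph V E)

/-- `α` is a path (of length `n + 1`): the source of each edge but the first lies in the range of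
the preceding edge. -/
def IsPath {n : ℕ} (α : Fin (n + 1) → E) : Prop :=
  ∀ i : Fin n, G.s (α i.succ) ∈ G.r (α i.castSucc)

/-- `α` is a closed path: a path of positive length whose source lies in its range. -/
def IsClosedPath {n : ℕ} (α : Fin (n + 1) → E) : Prop :=
  G.IsPath α ∧ G.s (α 0) ∈ G.r (α (Fin.last n))

/-- A sink is a vertex that emits no edge. -/
def IsSink (v : V) : Prop := ∀ e, G.s e ≠ v

/-- A closed path has an exit: either an edge `e` whose source lies in the range of some edge of the
path although `e` is not the next edge of the path, or a sink in the range of some edge of the path.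
The indices are cyclic: addition in `Fin (n + 1)` wraps around, so the edge that follows the last
one is the first one. -/
def HasExit {n : ℕ} (α : Fin (n + 1) → E) : Prop :=
  (∃ e : E, ∃ i : Fin (n + 1), G.s e ∈ G.r (α i) ∧ e ≠ α (i + 1)) ∨
    ∃ w : V, G.IsSink w ∧ ∃ i : Fin (n + 1), w ∈ G.r (α i)

/-- Condition (L): every closed path has an exit. -/
def ConditionL : Prop :=
  ∀ (n : ℕ) (α : Fin (n + 1) → E), G.IsClosedPath α → G.HasExit α

end ConditionL

/-! ### The Leavitt path algebra of an ultragraph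

It is the universal (not necessarily unital) associative `R`-algebra on the generators and relations
below, constructed as the quotient of the free non-unital associative algebra by the congruence that
the relations generate. -/

/-- The generators `s_e`, `s_e^*` and `p_A`. -/
inductive Gen {V : Type u} {E : Type v} (G : Ultragraph V E) : Type (max u v)
  | edge (e : E) : Gen G
  | ghost (e : E) : Gen G
  | proj (A : G.GenVertex) : Gen G

section Leavitt

variable (R : Type w) [CommRing R] {V : Type u} {E : Type v} (G : Ultragraph V E)

/-- The free non-unital associative `R`-algebra on the generators: `R`-linear combinations of
nonempty words. -/
abbrev FreeAlg : Type (max u v w) := MonoidAlgebra R (FreeSemigroup G.Gen)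

/-- A generator, as an element of the free algebra. -/
noncomputable def FreeAlg.gen (g : G.Gen) : G.FreeAlg R :=
  MonoidAlgebra.single (FreeSemigroup.of g) 1

local notation "S[" e "]" => FreeAlg.gen R G (Gen.edge e)
local notation "T[" e "]" => FreeAlg.gen R G (Gen.ghost e)
local notation "P[" A "]" => FreeAlg.gen R G (Gen.proj A)

/-- The defining relations of the Leavitt path algebra, closed under multiplication by scalars. -/
inductive Rel : G.FreeAlg R → G.FreeAlg R → Prop
  | proj_empty : Rel P[∅] 0
  | proj_mul (A B : G.GenVertex) : Rel (P[A] * P[B]) P[A ∩ B]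
  | proj_union (A B : G.GenVertex) : Rel P[A ∪ B] (P[A] + P[B] - P[A ∩ B])
  | source_edge (e : E) : Rel (P[G.vert (G.s e)] * S[e]) S[e]
  | edge_range (e : E) : Rel (S[e] * P[G.range e]) S[e]
  | range_ghost (e : E) : Rel (P[G.range e] * T[e]) T[e]
  | ghost_source (e : E) : Rel (T[e] * P[G.vert (G.s e)]) T[e]
  | ghost_edge_same (e : E) : Rel (T[e] * S[e]) P[G.range e]
  | ghost_edge_ne (e f : E) : e ≠ f → Rel (T[e] * S[f]) 0
  | vertex (v : V) (hfin : {e | G.s e = v}.Finite) (hne : {e | G.s e = v}.Nonempty) :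
      Rel P[G.vert v] (∑ e ∈ hfin.toFinset, S[e] * T[e])
  | smul (t : R) {a b : G.FreeAlg R} : Rel a b → Rel (t • a) (t • b)

/-- The ring congruence generated by the defining relations. -/
noncomputable def con : RingCon (G.FreeAlg R) := ringConGen (Rel R G)

/-- The congruence is compatible with scalars, so the quotient is an `R`-algebra. -/
theorem con_smul (t : R) {a b : G.FreeAlg R} (h : con R G a b) : con R G (t • a) (t • b) := by
  change RingConGen.Rel (Rel R G) a b at h
  induction h with
  | of _ _ h => exact RingConGen.Rel.of _ _ (h.smul t)
  | refl _ => exact (con R G).refl _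
  | symm _ ih => exact (con R G).symm ih
  | trans _ _ ih₁ ih₂ => exact (con R G).trans ih₁ ih₂
  | add _ _ ih₁ ih₂ => rw [smul_add, smul_add]; exact (con R G).add ih₁ ih₂
  | mul _ h₂ ih₁ _ => rw [← smul_mul_assoc, ← smul_mul_assoc]; exact (con R G).mul ih₁ h₂

/-- The ultragraph Leavitt path algebra `L_R(G)`. -/
def LeavittPathAlgebra : Type (max u v w) := (con R G).Quotient

namespace LeavittPathAlgebra

noncomputable instance : NonUnitalRing (LeavittPathAlgebra R G) :=
  inferInstanceAs (NonUnitalRing (con R G).Quotient)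

/-- The quotient map from the free algebra. -/
noncomputable def mk (a : G.FreeAlg R) : LeavittPathAlgebra R G := (a : (con R G).Quotient)

theorem mk_surjective : Function.Surjective (mk R G) := Quot.mk_surjective

theorem mk_add (a b : G.FreeAlg R) : mk R G (a + b) = mk R G a + mk R G b := rfl

theorem mk_mul (a b : G.FreeAlg R) : mk R G (a * b) = mk R G a * mk R G b := rfl

theorem mk_zero : mk R G 0 = 0 := rfl

noncomputable instance : SMul R (LeavittPathAlgebra R G) where
  smul t := Quotient.map' (t • ·) fun _ _ h => con_smul R G t h

theorem mk_smul (t : R) (a : G.FreeAlg R) : mk R G (t • a) = t • mk R G a := rfl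

noncomputable instance : Module R (LeavittPathAlgebra R G) where
  one_smul a := by
    obtain ⟨a, rfl⟩ := mk_surjective R G a
    rw [← mk_smul, one_smul]
  mul_smul t t' a := by
    obtain ⟨a, rfl⟩ := mk_surjective R G a
    simp only [← mk_smul, mul_smul]
  smul_zero t := by rw [← mk_zero, ← mk_smul, smul_zero]
  smul_add t a b := by
    obtain ⟨a, rfl⟩ := mk_surjective R G a
    obtain ⟨b, rfl⟩ := mk_surjective R G b
    simp only [← mk_smul, ← mk_add, smul_add]
  add_smul t t' a := by
    obtain ⟨a, rfl⟩ := mk_surjective R G a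
    simp only [← mk_smul, ← mk_add, add_smul]
  zero_smul a := by
    obtain ⟨a, rfl⟩ := mk_surjective R G a
    rw [← mk_smul, ← mk_zero, zero_smul]

instance : IsScalarTower R (LeavittPathAlgebra R G) (LeavittPathAlgebra R G) where
  smul_assoc t a b := by
    obtain ⟨a, rfl⟩ := mk_surjective R G a
    obtain ⟨b, rfl⟩ := mk_surjective R G b
    simp only [smul_eq_mul, ← mk_smul, ← mk_mul, smul_mul_assoc]

instance : SMulCommClass R (LeavittPathAlgebra R G) (LeavittPathAlgebra R G) where
  smul_comm t a b := by
    obtain ⟨a, rfl⟩ := mk_surjective R G a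
    obtain ⟨b, rfl⟩ := mk_surjective R G b
    simp only [smul_eq_mul, ← mk_smul, ← mk_mul, mul_smul_comm]

/-- The generator `s_e`. -/
noncomputable def edge (e : E) : LeavittPathAlgebra R G := mk R G S[e]

/-- The generator `s_e^*`. -/
noncomputable def ghost (e : E) : LeavittPathAlgebra R G := mk R G T[e]

/-- The generator `p_A`. -/
noncomputable def proj (A : G.GenVertex) : LeavittPathAlgebra R G := mk R G P[A]

end LeavittPathAlgebra

end Leavitt

/-- A family of elements of an `R`-algebra that satisfies the defining relations of `L_R(G)`. -/
structure LeavittFamily {V : Type u} {E : Type v} (G : Ultragraph V E) (B : Type x)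
    [NonUnitalRing B] where
  /-- The images of the `s_e`. -/
  edge : E → B
  /-- The images of the `s_e^*`. -/
  ghost : E → B
  /-- The images of the `p_A`. -/
  proj : G.GenVertex → B
  proj_empty : proj ∅ = 0
  proj_mul : ∀ A B, proj A * proj B = proj (A ∩ B)
  proj_union : ∀ A B, proj (A ∪ B) = proj A + proj B - proj (A ∩ B)
  source_edge : ∀ e, proj (G.vert (G.s e)) * edge e = edge e
  edge_range : ∀ e, edge e * proj (G.range e) = edge e
  range_ghost : ∀ e, proj (G.range e) * ghost e = ghost e
  ghost_source : ∀ e, ghost e * proj (G.vert (G.s e)) = ghost e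
  ghost_edge_same : ∀ e, ghost e * edge e = proj (G.range e)
  ghost_edge_ne : ∀ e f, e ≠ f → ghost e * edge f = 0
  vertex : ∀ v, ∀ hfin : {e | G.s e = v}.Finite, {e | G.s e = v}.Nonempty →
    proj (G.vert v) = ∑ e ∈ hfin.toFinset, edge e * ghost e

section Lift

variable {R : Type w} [CommRing R] {V : Type u} {E : Type v} {G : Ultragraph V E}
  {B : Type x} [NonUnitalRing B] [Module R B] [IsScalarTower R B B] [SMulCommClass R B B]

namespace LeavittFamily

/-- The value of a family on a generator. -/
def onGen (F : G.LeavittFamily B) : G.Gen → B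
  | .edge e => F.edge e
  | .ghost e => F.ghost e
  | .proj A => F.proj A

variable (R)

/-- The homomorphism on the free algebra given by a family. -/
noncomputable def freeLift (F : G.LeavittFamily B) : G.FreeAlg R →ₙₐ[R] B :=
  MonoidAlgebra.liftMagma R (FreeSemigroup.lift F.onGen)

theorem freeLift_gen (F : G.LeavittFamily B) (g : G.Gen) :
    F.freeLift R (FreeAlg.gen R G g) = F.onGen g := by
  simp [freeLift, FreeAlg.gen]

theorem freeLift_rel (F : G.LeavittFamily B) {a b : G.FreeAlg R} (h : Rel R G a b) :
    F.freeLift R a = F.freeLift R b := by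
  induction h with
  | proj_empty => simpa [freeLift_gen, onGen] using F.proj_empty
  | proj_mul A B => simpa [freeLift_gen, onGen] using F.proj_mul A B
  | proj_union A B => simpa [freeLift_gen, onGen] using F.proj_union A B
  | source_edge e => simpa [freeLift_gen, onGen] using F.source_edge e
  | edge_range e => simpa [freeLift_gen, onGen] using F.edge_range e
  | range_ghost e => simpa [freeLift_gen, onGen] using F.range_ghost e
  | ghost_source e => simpa [freeLift_gen, onGen] using F.ghost_source e
  | ghost_edge_same e => simpa [freeLift_gen, onGen] using F.ghost_edge_same e
  | ghost_edge_ne e f h => simpa [freeLift_gen, onGen] using F.ghost_edge_ne e f h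
  | vertex v hfin hne => simpa [freeLift_gen, onGen, map_sum] using F.vertex v hfin hne
  | smul t _ ih => rw [map_smul, map_smul, ih]

theorem freeLift_con (F : G.LeavittFamily B) {a b : G.FreeAlg R} (h : con R G a b) :
    F.freeLift R a = F.freeLift R b := by
  change RingConGen.Rel (Rel R G) a b at h
  induction h with
  | of _ _ h => exact F.freeLift_rel R h
  | refl _ => rfl
  | symm _ ih => exact ih.symm
  | trans _ _ ih₁ ih₂ => exact ih₁.trans ih₂
  | add _ _ ih₁ ih₂ => rw [map_add, map_add, ih₁, ih₂]
  | mul _ _ ih₁ ih₂ => rw [map_mul, map_mul, ih₁, ih₂]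

/-- The homomorphism `L_R(G) → B` given by a family, from the universal property of `L_R(G)`. -/
noncomputable def lift (F : G.LeavittFamily B) : LeavittPathAlgebra R G →ₙₐ[R] B where
  toFun := Quot.lift (F.freeLift R) fun _ _ h => F.freeLift_con R h
  map_smul' t a := by
    obtain ⟨a, rfl⟩ := LeavittPathAlgebra.mk_surjective R G a
    exact map_smul (F.freeLift R) t a
  map_zero' := map_zero (F.freeLift R)
  map_add' a b := by
    obtain ⟨a, rfl⟩ := LeavittPathAlgebra.mk_surjective R G a
    obtain ⟨b, rfl⟩ := LeavittPathAlgebra.mk_surjective R G b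
    exact map_add (F.freeLift R) a b
  map_mul' a b := by
    obtain ⟨a, rfl⟩ := LeavittPathAlgebra.mk_surjective R G a
    obtain ⟨b, rfl⟩ := LeavittPathAlgebra.mk_surjective R G b
    exact map_mul (F.freeLift R) a b

theorem lift_edge (F : G.LeavittFamily B) (e : E) :
    F.lift R (LeavittPathAlgebra.edge R G e) = F.edge e :=
  F.freeLift_gen R _

theorem lift_ghost (F : G.LeavittFamily B) (e : E) :
    F.lift R (LeavittPathAlgebra.ghost R G e) = F.ghost e :=
  F.freeLift_gen R _

theorem lift_proj (F : G.LeavittFamily B) (A : G.GenVertex) :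
    F.lift R (LeavittPathAlgebra.proj R G A) = F.proj A :=
  F.freeLift_gen R _

end LeavittFamily

end Lift

/-! ### Algebraic branching systems and the induced representations -/

/-- An algebraic branching system of an ultragraph on a set `X`. -/
structure BranchingSystem {V : Type u} {E : Type v} (G : Ultragraph V E) (X : Type x) where
  /-- The sets `R_e`. -/
  R : E → Set X
  /-- The sets `D_A`. -/
  D : G.GenVertex → Set X
  /-- The bijections `f_e : D_{r(e)} → R_e`. -/
  f : ∀ e, D (G.range e) ≃ R e
  R_disjoint : ∀ e e', e ≠ e' → R e ∩ R e' = ∅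
  D_empty : D ∅ = ∅
  D_inter : ∀ A B, D A ∩ D B = D (A ∩ B)
  D_union : ∀ A B, D A ∪ D B = D (A ∪ B)
  R_subset : ∀ e, R e ⊆ D (G.vert (G.s e))
  D_vert : ∀ v, {e | G.s e = v}.Finite → {e | G.s e = v}.Nonempty →
    D (G.vert v) = ⋃ e ∈ {e | G.s e = v}, R e

namespace BranchingSystem

variable (R : Type w) [CommRing R] {V : Type u} {E : Type v} {G : Ultragraph V E} {X : Type x}

open scoped Classical in
/-- The operator `S_e(φ) = (φ ∘ f_e⁻¹) · 1_{R_e}` on the module of all maps `X → R`. -/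
noncomputable def opS (B : G.BranchingSystem X) (e : E) : Module.End R (X → R) where
  toFun φ z := if h : z ∈ B.R e then φ ((B.f e).symm ⟨z, h⟩) else 0
  map_add' φ ψ := by ext z; by_cases h : z ∈ B.R e <;> simp [h]
  map_smul' t φ := by ext z; by_cases h : z ∈ B.R e <;> simp [h]

open scoped Classical in
/-- The operator `S_e^*(φ) = (φ ∘ f_e) · 1_{D_{r(e)}}`. -/
noncomputable def opSStar (B : G.BranchingSystem X) (e : E) : Module.End R (X → R) where
  toFun φ z := if h : z ∈ B.D (G.range e) then φ (B.f e ⟨z, h⟩) else 0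
  map_add' φ ψ := by ext z; by_cases h : z ∈ B.D (G.range e) <;> simp [h]
  map_smul' t φ := by ext z; by_cases h : z ∈ B.D (G.range e) <;> simp [h]

open scoped Classical in
/-- The operator `P_A(φ) = 1_{D_A} · φ`. -/
noncomputable def opP (B : G.BranchingSystem X) (A : G.GenVertex) : Module.End R (X → R) where
  toFun φ z := if z ∈ B.D A then φ z else 0
  map_add' φ ψ := by ext z; by_cases h : z ∈ B.D A <;> simp [h]
  map_smul' t φ := by ext z; by_cases h : z ∈ B.D A <;> simp [h]

open scoped Classical in
/-- The operators of a branching system satisfy the relations of the Leavitt path algebra. -/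
noncomputable def family (B : G.BranchingSystem X) :
    G.LeavittFamily (Module.End R (X → R)) where
  edge := B.opS R
  ghost := B.opSStar R
  proj := B.opP R
  proj_empty := by
    ext1 φ; ext z; simp [opP, B.D_empty]
  proj_mul A A' := by
    refine LinearMap.ext fun φ => funext fun z => ?_
    have hi : z ∈ B.D (A ∩ A') ↔ z ∈ B.D A ∧ z ∈ B.D A' := by rw [← B.D_inter]; rfl
    by_cases h : z ∈ B.D A <;> by_cases h' : z ∈ B.D A' <;> simp [opP, hi, h, h']
  proj_union A A' := by
    refine LinearMap.ext fun φ => funext fun z => ?_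
    have hi : z ∈ B.D (A ∩ A') ↔ z ∈ B.D A ∧ z ∈ B.D A' := by rw [← B.D_inter]; rfl
    have hu : z ∈ B.D (A ∪ A') ↔ z ∈ B.D A ∨ z ∈ B.D A' := by rw [← B.D_union]; rfl
    by_cases h : z ∈ B.D A <;> by_cases h' : z ∈ B.D A' <;> simp [opP, hi, hu, h, h']
  source_edge e := by
    refine LinearMap.ext fun φ => funext fun z => ?_
    by_cases h : z ∈ B.R e
    · simp [opP, opS, h, B.R_subset e h]
    · simp [opP, opS, h]
  edge_range e := by
    refine LinearMap.ext fun φ => funext fun z => ?_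
    by_cases h : z ∈ B.R e <;> simp [opP, opS, h]
  range_ghost e := by
    refine LinearMap.ext fun φ => funext fun z => ?_
    by_cases h : z ∈ B.D (G.range e) <;> simp [opP, opSStar, h]
  ghost_source e := by
    refine LinearMap.ext fun φ => funext fun z => ?_
    by_cases h : z ∈ B.D (G.range e)
    · simp [opP, opSStar, h, B.R_subset e (B.f e ⟨z, h⟩).2]
    · simp [opSStar, h]
  ghost_edge_same e := by
    refine LinearMap.ext fun φ => funext fun z => ?_
    by_cases h : z ∈ B.D (G.range e) <;> simp [opP, opS, opSStar, h]
  ghost_edge_ne e e' hee := by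
    refine LinearMap.ext fun φ => funext fun z => ?_
    by_cases h : z ∈ B.D (G.range e)
    · have hn : (B.f e ⟨z, h⟩ : X) ∉ B.R e' := fun h' =>
        (B.R_disjoint e e' hee).le ⟨(B.f e ⟨z, h⟩).2, h'⟩
      simp [opS, opSStar, h, hn]
    · simp [opSStar, h]
  vertex v hfin hne := by
    refine LinearMap.ext fun φ => funext fun z => ?_
    have key : ∀ e, (B.opS R e * B.opSStar R e) φ z = if z ∈ B.R e then φ z else 0 := by
      intro e
      by_cases h : z ∈ B.R e <;> simp [opS, opSStar, h]
    rw [LinearMap.sum_apply, Finset.sum_apply, Finset.sum_congr rfl fun e _ => key e]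
    by_cases h : z ∈ B.D (G.vert v)
    · have h' := h
      rw [B.D_vert v hfin hne] at h'
      obtain ⟨e, he, hze⟩ := Set.mem_iUnion₂.1 h'
      rw [Finset.sum_eq_single e]
      · simp [opP, h, hze]
      · intro e' _ hne'
        rw [if_neg]
        exact fun hz => (B.R_disjoint e' e hne').le ⟨hz, hze⟩
      · intro hn
        exact absurd (hfin.mem_toFinset.2 he) hn
    · rw [Finset.sum_eq_zero]
      · simp [opP, h]
      · intro e he
        rw [if_neg]
        intro hz
        have hs : G.s e = v := hfin.mem_toFinset.1 he
        exact h (hs ▸ B.R_subset e hz)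

/-- The representation `π : L_R(G) → Hom_R(M)` induced by a branching system on `X`, where `M` is
the `R`-module of all maps `X → R`. It is the homomorphism with `π(s_e) = S_e`,
`π(s_e^*) = S_e^*` and `π(p_A) = P_A`. -/
noncomputable def rep (B : G.BranchingSystem X) :
    LeavittPathAlgebra R G →ₙₐ[R] Module.End R (X → R) :=
  (B.family R).lift R

theorem rep_edge (B : G.BranchingSystem X) (e : E) :
    B.rep R (LeavittPathAlgebra.edge R G e) = B.opS R e :=
  (B.family R).lift_edge R e

theorem rep_ghost (B : G.BranchingSystem X) (e : E) :
    B.rep R (LeavittPathAlgebra.ghost R G e) = B.opSStar R e :=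
  (B.family R).lift_ghost R e

theorem rep_proj (B : G.BranchingSystem X) (A : G.GenVertex) :
    B.rep R (LeavittPathAlgebra.proj R G A) = B.opP R A :=
  (B.family R).lift_proj R A

end BranchingSystem

end Ultragraph

universe y

namespace Ultragraph

variable {R : Type w} [CommRing R] {V : Type u} {E : Type v} {G : Ultragraph V E}

theorem GenVertex.ext' {A B : G.GenVertex} (h : A.toSet = B.toSet) : A = B := Subtype.ext h

@[simp] theorem GenVertex.toSet_inter (A B : G.GenVertex) :
    (A ∩ B).toSet = A.toSet ∩ B.toSet := rfl

@[simp] theorem GenVertex.toSet_union (A B : G.GenVertex) :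
    (A ∪ B).toSet = A.toSet ∪ B.toSet := rfl

@[simp] theorem toSet_vert (v : V) : (G.vert v).toSet = {v} := rfl

theorem inter_vert_of_mem {A : G.GenVertex} {v : V} (h : v ∈ A.toSet) :
    A ∩ G.vert v = G.vert v :=
  GenVertex.ext' (Set.inter_eq_right.2 (Set.singleton_subset_iff.2 h))

theorem inter_vert_of_notMem {A : G.GenVertex} {v : V} (h : v ∉ A.toSet) :
    A ∩ G.vert v = ∅ :=
  GenVertex.ext' (Set.inter_singleton_eq_empty.2 h)

theorem vert_inter_of_mem {A : G.GenVertex} {v : V} (h : v ∈ A.toSet) :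
    G.vert v ∩ A = G.vert v :=
  GenVertex.ext' (Set.inter_eq_left.2 (Set.singleton_subset_iff.2 h))

theorem vert_inter_of_notMem {A : G.GenVertex} {v : V} (h : v ∉ A.toSet) :
    G.vert v ∩ A = ∅ :=
  GenVertex.ext' (Set.singleton_inter_eq_empty.2 h)

namespace LeavittPathAlgebra

/-! ### The defining relations -/

theorem mk_rel {a b : G.FreeAlg R} (h : Rel R G a b) : mk R G a = mk R G b :=
  (RingCon.eq (con R G)).2 (RingConGen.Rel.of _ _ h)

theorem proj_empty : proj R G ∅ = 0 := mk_rel .proj_empty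

theorem proj_mul (A B : G.GenVertex) : proj R G A * proj R G B = proj R G (A ∩ B) :=
  mk_rel (.proj_mul A B)

theorem proj_union (A B : G.GenVertex) :
    proj R G (A ∪ B) = proj R G A + proj R G B - proj R G (A ∩ B) :=
  mk_rel (.proj_union A B)

theorem source_edge (e : E) : proj R G (G.vert (G.s e)) * edge R G e = edge R G e :=
  mk_rel (.source_edge e)

theorem edge_range (e : E) : edge R G e * proj R G (G.range e) = edge R G e :=
  mk_rel (.edge_range e)

theorem range_ghost (e : E) : proj R G (G.range e) * ghost R G e = ghost R G e :=
  mk_rel (.range_ghost e)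

theorem ghost_source (e : E) : ghost R G e * proj R G (G.vert (G.s e)) = ghost R G e :=
  mk_rel (.ghost_source e)

theorem ghost_edge_same (e : E) : ghost R G e * edge R G e = proj R G (G.range e) :=
  mk_rel (.ghost_edge_same e)

theorem ghost_edge_ne {e f : E} (h : e ≠ f) : ghost R G e * edge R G f = 0 :=
  mk_rel (.ghost_edge_ne e f h)

theorem vertex (v : V) (hfin : {e | G.s e = v}.Finite) (hne : {e | G.s e = v}.Nonempty) :
    proj R G (G.vert v) = ∑ e ∈ hfin.toFinset, edge R G e * ghost R G e := by
  have h := mk_rel (R := R) (.vertex v hfin hne)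
  let f : G.FreeAlg R →+ LeavittPathAlgebra R G :=
    { toFun := mk R G, map_zero' := rfl, map_add' := mk_add R G }
  exact h.trans (map_sum f _ _)

theorem proj_mul_vert_of_mem {A : G.GenVertex} {v : V} (h : v ∈ A.toSet) :
    proj R G A * proj R G (G.vert v) = proj R G (G.vert v) := by
  rw [proj_mul, inter_vert_of_mem h]

theorem proj_mul_vert_of_notMem {A : G.GenVertex} {v : V} (h : v ∉ A.toSet) :
    proj R G A * proj R G (G.vert v) = 0 := by
  rw [proj_mul, inter_vert_of_notMem h, proj_empty]

theorem vert_mul_proj_of_mem {A : G.GenVertex} {v : V} (h : v ∈ A.toSet) :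
    proj R G (G.vert v) * proj R G A = proj R G (G.vert v) := by
  rw [proj_mul, vert_inter_of_mem h]

theorem vert_mul_proj_of_notMem {A : G.GenVertex} {v : V} (h : v ∉ A.toSet) :
    proj R G (G.vert v) * proj R G A = 0 := by
  rw [proj_mul, vert_inter_of_notMem h, proj_empty]

theorem proj_mul_edge_of_mem {A : G.GenVertex} {e : E} (h : G.s e ∈ A.toSet) :
    proj R G A * edge R G e = edge R G e := by
  rw [← source_edge, ← mul_assoc, proj_mul_vert_of_mem h]

theorem proj_mul_edge_of_notMem {A : G.GenVertex} {e : E} (h : G.s e ∉ A.toSet) :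
    proj R G A * edge R G e = 0 := by
  rw [← source_edge, ← mul_assoc, proj_mul_vert_of_notMem h, zero_mul]

theorem ghost_mul_proj_of_mem {A : G.GenVertex} {e : E} (h : G.s e ∈ A.toSet) :
    ghost R G e * proj R G A = ghost R G e := by
  rw [← ghost_source, mul_assoc, vert_mul_proj_of_mem h]

theorem ghost_mul_proj_of_notMem {A : G.GenVertex} {e : E} (h : G.s e ∉ A.toSet) :
    ghost R G e * proj R G A = 0 := by
  rw [← ghost_source, mul_assoc, vert_mul_proj_of_notMem h, mul_zero]

/-! ### Multiplication by paths -/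

variable (R G) in
/-- Left multiplication by the product of the generators `s_e` along a list of edges. -/
noncomputable def pathMul : List E → LeavittPathAlgebra R G →ₗ[R] LeavittPathAlgebra R G
  | [] => LinearMap.id
  | e :: μ => LinearMap.mulLeft R (edge R G e) ∘ₗ pathMul μ

@[simp] theorem pathMul_nil (a : LeavittPathAlgebra R G) : pathMul R G [] a = a := rfl

@[simp] theorem pathMul_cons (e : E) (μ : List E) (a : LeavittPathAlgebra R G) :
    pathMul R G (e :: μ) a = edge R G e * pathMul R G μ a := rfl

theorem pathMul_mul (μ : List E) (a b : LeavittPathAlgebra R G) :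
    pathMul R G μ a * b = pathMul R G μ (a * b) := by
  induction μ with
  | nil => rfl
  | cons e μ ih => simp [mul_assoc, ih]

theorem pathMul_append (μ ν : List E) (a : LeavittPathAlgebra R G) :
    pathMul R G (μ ++ ν) a = pathMul R G μ (pathMul R G ν a) := by
  induction μ with
  | nil => rfl
  | cons e μ ih => simp [ih]

end LeavittPathAlgebra

/-! ### Paths with a prescribed end vertex -/

variable (G)

/-- The source of the path `μ`, where the empty path starts at its end point `v`. -/
def src : List E → V → V
  | [], v => v
  | e :: _, _ => G.s e

/-- The list of edges `μ` is a path that ends at the vertex `v`. -/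
def IsPathTo : List E → V → Prop
  | [], _ => True
  | e :: μ, v => G.src μ v ∈ G.r e ∧ IsPathTo μ v

variable {G}

theorem IsPathTo.concat {μ : List E} {e : E} {w : V} (h : G.IsPathTo μ (G.s e))
    (hw : w ∈ G.r e) : G.IsPathTo (μ ++ [e]) w := by
  induction μ with
  | nil => exact ⟨hw, trivial⟩
  | cons f μ ih =>
    refine ⟨?_, ih h.2⟩
    have := h.1
    cases μ <;> exact this

namespace LeavittPathAlgebra

theorem proj_mul_pathMul_of_mem {A : G.GenVertex} {μ : List E} {v : V}
    (h : G.src μ v ∈ A.toSet) :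
    proj R G A * pathMul R G μ (proj R G (G.vert v)) = pathMul R G μ (proj R G (G.vert v)) := by
  cases μ with
  | nil => exact proj_mul_vert_of_mem h
  | cons e μ => rw [pathMul_cons, ← mul_assoc, proj_mul_edge_of_mem h]

theorem proj_mul_pathMul_of_notMem {A : G.GenVertex} {μ : List E} {v : V}
    (h : G.src μ v ∉ A.toSet) :
    proj R G A * pathMul R G μ (proj R G (G.vert v)) = 0 := by
  cases μ with
  | nil => exact proj_mul_vert_of_notMem h
  | cons e μ => rw [pathMul_cons, ← mul_assoc, proj_mul_edge_of_notMem h, zero_mul]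

theorem pathMul_vert_of_not_isPathTo {μ : List E} {v : V} (h : ¬ G.IsPathTo μ v) :
    pathMul R G μ (proj R G (G.vert v)) = 0 := by
  induction μ with
  | nil => exact absurd trivial h
  | cons e μ ih =>
    by_cases h' : G.src μ v ∈ G.r e
    · rw [pathMul_cons, ih fun hμ => h ⟨h', hμ⟩, mul_zero]
    · rw [pathMul_cons, ← edge_range, mul_assoc, proj_mul_pathMul_of_notMem (A := G.range e) h', mul_zero]

/-- Left multiplication by a nonempty path is zero, or it can be undone up to a projection. -/
theorem pathMul_eq_zero_or_exists (e : E) (μ : List E) :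
    (∀ a, pathMul R G (e :: μ) a = 0) ∨
      ∃ A : G.GenVertex, (∀ a, pathMul R G (e :: μ) (proj R G A * a) = pathMul R G (e :: μ) a) ∧
        ∀ a, pathMul R G (e :: μ) a = 0 → proj R G A * a = 0 := by
  induction μ generalizing e with
  | nil =>
    refine .inr ⟨G.range e, fun a => ?_, fun a ha => ?_⟩
    · simp [← mul_assoc, edge_range]
    · rw [← ghost_edge_same, mul_assoc]
      exact (congrArg _ ha).trans (mul_zero _)
  | cons f μ ih =>
    -- If `s(f) ∈ r(e)`, then `s_e^* s_e s_f = s_f`, so the projection found for the shorter path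
    -- still works; otherwise `s_e s_f = 0`.
    by_cases hf : G.s f ∈ G.r e
    · rcases ih f with h | ⟨A, h₁, h₂⟩
      · exact .inl fun a => by rw [pathMul_cons, h, mul_zero]
      · refine .inr ⟨A, fun a => by rw [pathMul_cons, h₁, ← pathMul_cons], fun a ha => h₂ a ?_⟩
        rw [pathMul_cons, ← proj_mul_edge_of_mem (A := G.range e) hf, ← ghost_edge_same, mul_assoc,
          mul_assoc]
        exact (congrArg _ ha).trans (mul_zero _)
    · refine .inl fun a => ?_
      rw [pathMul_cons, pathMul_cons, ← edge_range, mul_assoc, ← mul_assoc (proj R G _),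
        proj_mul_edge_of_notMem (A := G.range e) hf, zero_mul, mul_zero]

end LeavittPathAlgebra

end Ultragraph

namespace Ultragraph

variable {R : Type w} [CommRing R] {V : Type u} {E : Type v} {G : Ultragraph V E}

namespace LeavittPathAlgebra

variable {B : Type x} [NonUnitalRing B] [Module R B]

/-! ### Elements of the kernel supported on closed paths -/

/-- Compressing the path `β` by an edge `e` rotates it or kills it. -/
theorem compress_pathMul {e : E} {v w : V} (hv : G.s e = v) (hw : w ∈ G.r e) (β : List E)
    (hβ : β ≠ []) [Decidable (β.head? = some e ∧ G.src (β.rotate 1) w = w)] :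
    proj R G (G.vert w) * (ghost R G e * (pathMul R G β (proj R G (G.vert v)) *
      (edge R G e * proj R G (G.vert w)))) =
    if β.head? = some e ∧ G.src (β.rotate 1) w = w then
      pathMul R G (β.rotate 1) (proj R G (G.vert w)) else 0 := by
  obtain ⟨f, μ, rfl⟩ := List.exists_cons_of_ne_nil hβ
  have h₁ : pathMul R G (f :: μ) (proj R G (G.vert v)) * (edge R G e * proj R G (G.vert w)) =
      edge R G f * pathMul R G (μ ++ [e]) (proj R G (G.vert w)) := by
    rw [pathMul_mul, ← mul_assoc, ← hv, source_edge, pathMul_append]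
    rfl
  rw [h₁]
  by_cases hfe : f = e
  · subst hfe
    have h₂ : (f :: μ).rotate 1 = μ ++ [f] := by simp
    rw [← mul_assoc (ghost R G f), ghost_edge_same, ← mul_assoc,
      vert_mul_proj_of_mem (A := G.range f) hw, ← h₂]
    by_cases h : G.src ((f :: μ).rotate 1) w = w
    · rw [if_pos ⟨rfl, h⟩, proj_mul_pathMul_of_mem (A := G.vert w) h]
    · rw [if_neg fun h' => h h'.2, proj_mul_pathMul_of_notMem (A := G.vert w) h]
  · rw [if_neg, ← mul_assoc (ghost R G e), ghost_edge_ne (Ne.symm hfe), zero_mul, mul_zero]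
    rintro ⟨h, -⟩
    exact hfe (Option.some.inj h)

theorem compress_vert {e : E} {v w : V} (hv : G.s e = v) (hw : w ∈ G.r e) :
    proj R G (G.vert w) * (ghost R G e * (proj R G (G.vert v) *
      (edge R G e * proj R G (G.vert w)))) = proj R G (G.vert w) := by
  rw [← mul_assoc (proj R G (G.vert v)), ← hv, source_edge, ← mul_assoc (ghost R G e),
    ghost_edge_same, proj_mul_vert_of_mem (A := G.range e) hw,
    proj_mul_vert_of_mem (A := G.vert w) rfl]

variable (φ : LeavittPathAlgebra R G →ₙₐ[R] B)

/-- The element `t p_v + ∑ c_i s_{β_i} p_v` lies in the kernel of `φ`, with nonempty paths `β_i`. -/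
def KernelRelation {ι : Type y} (t : R) (c : ι → R) (F : Finset ι) (β : ι → List E) (v : V) :
    Prop :=
  (∀ i ∈ F, β i ≠ []) ∧
    φ (t • proj R G (G.vert v) + ∑ i ∈ F, c i • pathMul R G (β i) (proj R G (G.vert v))) = 0

variable {φ} {ι : Type y} {t : R} {c : ι → R} {F : Finset ι} {β : ι → List E} {v : V}

open scoped Classical in
theorem KernelRelation.filter_src (h : KernelRelation φ t c F β v) :
    KernelRelation φ t c (F.filter fun i => G.src (β i) v = v) β v := by
  refine ⟨fun i hi => h.1 i (Finset.mem_filter.1 hi).1, ?_⟩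
  have h₀ := congrArg (φ (proj R G (G.vert v)) * ·) h.2
  simp only [← map_mul, mul_zero] at h₀
  rw [← h₀, mul_add, mul_smul_comm, proj_mul_vert_of_mem (A := G.vert v) rfl, Finset.mul_sum,
    Finset.sum_filter]
  congr 2
  refine Finset.sum_congr rfl fun i _ => ?_
  rw [mul_smul_comm]
  split_ifs with hi
  · rw [proj_mul_pathMul_of_mem (A := G.vert v) hi]
  · rw [proj_mul_pathMul_of_notMem (A := G.vert v) hi, smul_zero]

open scoped Classical in
-- The index type `ι` stays fixed while the lists rotate, so no injectivity of rotation is needed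
-- and terms can only be lost.
theorem KernelRelation.filter_rotate (h : KernelRelation φ t c F β v) {e : E} {w : V}
    (hv : G.s e = v) (hw : w ∈ G.r e) :
    KernelRelation φ t c
      (F.filter fun i => (β i).head? = some e ∧ G.src ((β i).rotate 1) w = w)
      (fun i => (β i).rotate 1) w := by
  refine ⟨fun i hi => ?_, ?_⟩
  · rw [Ne, List.rotate_eq_nil_iff]
    exact h.1 i (Finset.mem_filter.1 hi).1
  have h₀ := congrArg (fun a => φ (proj R G (G.vert w)) * (φ (ghost R G e) * (a *
    φ (edge R G e * proj R G (G.vert w))))) h.2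
  simp only [← map_mul, zero_mul, mul_zero] at h₀
  rw [← h₀, add_mul, mul_add, mul_add, smul_mul_assoc, mul_smul_comm, mul_smul_comm,
    compress_vert hv hw, Finset.sum_mul, Finset.mul_sum, Finset.mul_sum, Finset.sum_filter]
  congr 2
  refine Finset.sum_congr rfl fun i hi => ?_
  rw [smul_mul_assoc, mul_smul_comm, mul_smul_comm, compress_pathMul hv hw (β i) (h.1 i hi),
    smul_ite, smul_zero]

/-- Under Condition (L), no element `t p_v + ∑ c_i s_{β_i} p_v` with `t ≠ 0` and nonempty paths
`β_i` lies in the kernel. -/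
theorem not_kernelRelation (hL : G.ConditionL)
    (hφ : ∀ (t : R) (v : V), φ (t • proj R G (G.vert v)) = 0 → t = 0) (ht : t ≠ 0) :
    ¬ KernelRelation φ t c F β v := by
  classical
  induction hm : F.card using Nat.strong_induction_on generalizing F β v with
  | _ m ih =>
  subst hm
  intro h
  -- Minimality of the number of terms: a filtered relation has the same `t ≠ 0`, so it cannot be
  -- shorter.
  have eq_of_filter : ∀ {p : ι → Prop} [DecidablePred p] {β' : ι → List E} {v' : V},
      KernelRelation φ t c (F.filter p) β' v' → F.filter p = F := by
    intro p _ β' v' h'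
    by_contra hne
    exact ih _ (Finset.card_lt_card ((Finset.filter_subset p F).ssubset_of_ne hne)) rfl h'
  have src_eq : ∀ {β' : ι → List E} {v' : V}, KernelRelation φ t c F β' v' →
      ∀ i ∈ F, G.src (β' i) v' = v' := fun h' =>
    Finset.filter_eq_self.1 (eq_of_filter h'.filter_src)
  -- Both `e` and `w` are arbitrary here. This freedom later forces the next edge and the range
  -- vertex to be unique.
  have step : ∀ {β' : ι → List E} {v' : V}, KernelRelation φ t c F β' v' →
      ∀ (e : E) (w : V), G.s e = v' → w ∈ G.r e → (∀ i ∈ F, (β' i).head? = some e) ∧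
        KernelRelation φ t c F (fun i => (β' i).rotate 1) w := by
    intro β' v' h' e w hv hw
    have h'' := h'.filter_rotate hv hw
    have hF := eq_of_filter h''
    rw [hF] at h''
    exact ⟨fun i hi => (Finset.filter_eq_self.1 hF i hi).1, h''⟩
  rcases F.eq_empty_or_nonempty with rfl | ⟨i, hi⟩
  · refine ht (hφ t v ?_)
    simpa using h.2
  have head_eq : ∀ {β' : ι → List E} {v' : V}, KernelRelation φ t c F β' v' →
      ∃ e, (β' i).head? = some e ∧ G.s e = v' := by
    intro β' v' h'
    obtain ⟨e, μ, he⟩ := List.exists_cons_of_ne_nil (h'.1 i hi)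
    have hs := src_eq h' i hi
    rw [he] at hs ⊢
    exact ⟨e, rfl, hs⟩
  have all : ∀ k : ℕ, ∃ v', KernelRelation φ t c F (fun j => (β j).rotate k) v' := by
    intro k
    induction k with
    | zero => exact ⟨v, by simpa using h⟩
    | succ k ihk =>
      obtain ⟨v', h'⟩ := ihk
      obtain ⟨e, -, hv⟩ := head_eq h'
      obtain ⟨w, hw⟩ := G.r_nonempty e
      refine ⟨w, ?_⟩
      simpa only [List.rotate_rotate] using (step h' e w hv hw).2
  obtain ⟨n, hn⟩ : ∃ n, (β i).length = n + 1 :=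
    Nat.exists_eq_succ_of_ne_zero fun h0 => h.1 i hi (List.length_eq_zero_iff.1 h0)
  -- Any one of the lists serves as the closed path without exit.
  let α : Fin (n + 1) → E := fun j => (β i)[j.1]'(by omega)
  have head_α : ∀ j : Fin (n + 1), ((β i).rotate j.1).head? = some (α j) := fun j => by
    rw [List.head?_rotate (by omega)]
    exact List.getElem?_eq_getElem _
  have head_α' : ∀ j : Fin (n + 1), ((β i).rotate (j.1 + 1)).head? = some (α (j + 1)) := fun j => by
    rw [← head_α, Fin.val_add, ← List.rotate_mod, hn]
    congr 2
    simp
  -- Rotate until `α j` is in front, then compress by `α j` and `w`: the lists now start at `w` with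
  -- `α (j + 1)`. A further compression by any edge `f` leaving `w` shows that they also start with
  -- `f`.
  have key : ∀ j : Fin (n + 1), ∀ w ∈ G.r (α j),
      G.s (α (j + 1)) = w ∧ ∀ e, G.s e = w → e = α (j + 1) := by
    intro j w hw
    obtain ⟨v', h'⟩ := all j
    obtain ⟨e, he, hv⟩ := head_eq h'
    obtain rfl : α j = e := Option.some.inj ((head_α j).symm.trans he)
    have h₁ := (step h' _ w hv hw).2
    simp only [List.rotate_rotate] at h₁
    obtain ⟨e, he, hw⟩ := head_eq h₁
    obtain rfl : α (j + 1) = e := Option.some.inj ((head_α' j).symm.trans he)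
    refine ⟨hw, fun f hf => ?_⟩
    obtain ⟨w', hw'⟩ := G.r_nonempty f
    exact Option.some.inj (((step h₁ f w' hf hw').1 i hi).symm.trans he)
  have mem : ∀ j : Fin (n + 1), G.s (α (j + 1)) ∈ G.r (α j) := fun j => by
    obtain ⟨w, hw⟩ := G.r_nonempty (α j)
    rwa [(key j w hw).1]
  rcases hL n α ⟨fun j => by simpa using mem j.castSucc, by simpa using mem (Fin.last n)⟩ with
    ⟨e, j, he, hne⟩ | ⟨w, hw, j, hj⟩
  · exact hne ((key j _ he).2 e rfl)
  · exact hw _ (key j w hj).1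

/-! ### Independence of paths modulo the kernel -/

/-- The coefficient of the empty path vanishes by `not_kernelRelation`. Left multiplication by
`s_e^*` strips `e` from the paths that begin with it and kills the other nonempty ones, which allows
induction on the path. -/
theorem coeff_eq_zero_of_mem_kernel (hL : G.ConditionL)
    (hφ : ∀ (t : R) (v : V), φ (t • proj R G (G.vert v)) = 0 → t = 0)
    {F : Finset (List E)} {c : List E → R} {v : V} (hF : ∀ μ ∈ F, G.IsPathTo μ v)
    (h : φ (∑ μ ∈ F, c μ • pathMul R G μ (proj R G (G.vert v))) = 0) :
    ∀ μ ∈ F, c μ = 0 := by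
  classical
  intro μ
  induction μ generalizing F c with
  | nil =>
    intro hμ
    by_contra hc
    refine not_kernelRelation (F := F.erase []) (β := id) (c := c) (v := v) hL hφ hc
      ⟨fun i hi => Finset.ne_of_mem_erase hi, ?_⟩
    rw [← h, ← Finset.add_sum_erase _ _ hμ]
    rfl
  | cons e μ ih =>
    intro hμ
    -- The empty path must go first: multiplied by `s_e^*` it would leave a ghost term that is not
    -- of the form `s_ν p_v`.
    have hnil : [] ∈ F → c [] = 0 := by
      intro hm
      by_contra hc
      refine not_kernelRelation (F := F.erase []) (β := id) (c := c) (v := v) hL hφ hc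
        ⟨fun i hi => Finset.ne_of_mem_erase hi, ?_⟩
      rw [← h, ← Finset.add_sum_erase _ _ hm]
      rfl
    have hinj : Set.InjOn (List.cons e) (List.cons e ⁻¹' (F : Set (List E))) :=
      fun a _ b _ hab => List.cons_injective hab
    refine ih (F := F.preimage (List.cons e) hinj) (c := fun ν => c (e :: ν))
      (fun ν hν => (hF _ (Finset.mem_preimage.1 hν)).2) ?_ (Finset.mem_preimage.2 hμ)
    have h₀ := congrArg (φ (ghost R G e) * ·) h
    simp only [← map_mul, mul_zero] at h₀
    rw [← h₀, Finset.mul_sum, ← Finset.sum_preimage (List.cons e) F hinj]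
    · congr 1
      refine Finset.sum_congr rfl fun ν hν => ?_
      rw [mul_smul_comm, pathMul_cons, ← mul_assoc, ghost_edge_same,
        proj_mul_pathMul_of_mem (A := G.range e) (hF _ (Finset.mem_preimage.1 hν)).1]
    · intro ν hν hne
      rcases ν with _ | ⟨f, ν⟩
      · rw [hnil hν, zero_smul, mul_zero]
      · have hfe : e ≠ f := fun hfe => hne ⟨ν, by rw [hfe]⟩
        rw [mul_smul_comm, pathMul_cons, ← mul_assoc, ghost_edge_ne hfe, zero_mul, smul_zero]

end LeavittPathAlgebra

end Ultragraph

namespace Ultragraph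

variable {R : Type w} [CommRing R] {V : Type u} {E : Type v} {G : Ultragraph V E}

namespace LeavittPathAlgebra

/-! ### The span of the projections -/

variable (R G) in
/-- The span of the projections `p_A`. -/
noncomputable def projSpan : Submodule R (LeavittPathAlgebra R G) :=
  Submodule.span R (Set.range (proj R G))

theorem proj_mem_projSpan (A : G.GenVertex) : proj R G A ∈ projSpan R G :=
  Submodule.subset_span ⟨A, rfl⟩

theorem mul_proj_mem_projSpan {a : LeavittPathAlgebra R G} (ha : a ∈ projSpan R G)
    (A : G.GenVertex) : a * proj R G A ∈ projSpan R G := by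
  induction ha using Submodule.span_induction with
  | mem a ha =>
    obtain ⟨B, rfl⟩ := ha
    rw [proj_mul]
    exact proj_mem_projSpan _
  | zero => rw [zero_mul]; exact zero_mem _
  | add a b _ _ iha ihb => rw [add_mul]; exact add_mem iha ihb
  | smul t a _ ih => rw [smul_mul_assoc]; exact Submodule.smul_mem _ t ih

theorem proj_mul_mem_projSpan {a : LeavittPathAlgebra R G} (ha : a ∈ projSpan R G)
    (A : G.GenVertex) : proj R G A * a ∈ projSpan R G := by
  induction ha using Submodule.span_induction with
  | mem a ha =>
    obtain ⟨B, rfl⟩ := ha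
    rw [proj_mul]
    exact proj_mem_projSpan _
  | zero => rw [mul_zero]; exact zero_mem _
  | add a b _ _ iha ihb => rw [mul_add]; exact add_mem iha ihb
  | smul t a _ ih => rw [mul_smul_comm]; exact Submodule.smul_mem _ t ih

theorem exists_mul_vert_eq_smul {a : LeavittPathAlgebra R G} (ha : a ∈ projSpan R G) (v : V) :
    ∃ t : R, a * proj R G (G.vert v) = t • proj R G (G.vert v) := by
  induction ha using Submodule.span_induction with
  | mem a ha =>
    obtain ⟨B, rfl⟩ := ha
    by_cases h : v ∈ B.toSet
    · exact ⟨1, by rw [proj_mul_vert_of_mem h, one_smul]⟩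
    · exact ⟨0, by rw [proj_mul_vert_of_notMem h, zero_smul]⟩
  | zero => exact ⟨0, by rw [zero_mul, zero_smul]⟩
  | add a b _ _ iha ihb =>
    obtain ⟨s, hs⟩ := iha
    obtain ⟨t, ht⟩ := ihb
    exact ⟨s + t, by rw [add_mul, hs, ht, add_smul]⟩
  | smul t a _ ih =>
    obtain ⟨s, hs⟩ := ih
    exact ⟨t * s, by rw [smul_mul_assoc, hs, mul_smul]⟩

open scoped Classical in
/-- If the function `∑ c_C 1_C` takes the constant value `t` on `A \ B`, then `∑ c_C p_C` acts as
`t` on the projection `p_A - p_{A ∩ B}`. -/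
theorem sum_smul_proj_mul_sub (S : Finset G.GenVertex) (c : G.GenVertex → R) (t : R)
    (A B : G.GenVertex)
    (h : ∀ v ∈ A.toSet, v ∉ B.toSet → ∑ C ∈ S with v ∈ C.toSet, c C = t) :
    (∑ C ∈ S, c C • proj R G C) * (proj R G A - proj R G (A ∩ B)) =
      t • (proj R G A - proj R G (A ∩ B)) := by
  -- Generalized vertices need not be closed under differences, so `A \ B` is carried as a pair. A
  -- new set `D` splits it into `(A ∩ D) \ B`, where the remaining sum is `t - c D`, and `A \ (B ∪
  -- D)`, where it is still `t`.
  induction S using Finset.induction_on generalizing t A B with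
  | empty =>
    by_cases hAB : A.toSet ⊆ B.toSet
    · have : A ∩ B = A := GenVertex.ext' (Set.inter_eq_left.2 hAB)
      rw [this, sub_self, mul_zero, smul_zero]
    · obtain ⟨v, hvA, hvB⟩ := Set.not_subset.1 hAB
      obtain rfl : 0 = t := by simpa using h v hvA hvB
      simp
  | insert D S hD ih =>
    have h₁ := ih (t - c D) (A ∩ D) B fun v hv hvB => by
      rw [← h v hv.1 hvB, Finset.filter_insert, if_pos (show v ∈ D.toSet from hv.2), Finset.sum_insert (by simp [hD]),
        add_sub_cancel_left]
    have h₂ := ih t A (B ∪ D) fun v hv hvB => by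
      rw [← h v hv fun h' => hvB (.inl h'), Finset.filter_insert, if_neg (show v ∉ D.toSet from fun h' => hvB (.inr h'))]
    have e₁ : proj R G D * (proj R G (A ∩ D) - proj R G (A ∩ D ∩ B)) =
        proj R G (A ∩ D) - proj R G (A ∩ D ∩ B) := by
      rw [mul_sub, proj_mul, proj_mul]
      congr 2 <;> exact GenVertex.ext' (by ext; simp <;> tauto)
    have e₂ : proj R G D * (proj R G A - proj R G (A ∩ (B ∪ D))) = 0 := by
      rw [mul_sub, proj_mul, proj_mul, sub_eq_zero]
      congr 1
      exact GenVertex.ext' (by ext; simp ; tauto)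
    have e₃ : proj R G A - proj R G (A ∩ B) =
        (proj R G (A ∩ D) - proj R G (A ∩ D ∩ B)) +
          (proj R G A - proj R G (A ∩ (B ∪ D))) := by
      have i₁ : A ∩ (B ∪ D) = (A ∩ B) ∪ (A ∩ D) :=
        GenVertex.ext' (by ext; simp ; tauto)
      have i₂ : (A ∩ B) ∩ (A ∩ D) = A ∩ D ∩ B := GenVertex.ext' (by ext; simp ; tauto)
      rw [i₁, proj_union, i₂]
      abel
    rw [e₃, Finset.sum_insert hD, add_mul, mul_add, mul_add, h₁, h₂, smul_mul_assoc,
      smul_mul_assoc, e₁, e₂, sub_smul, smul_add, smul_zero]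
    abel

/-- An element `∑ c_C p_C` killed by all `p_v` has zero coefficient function `∑ c_C 1_C`, so it
annihilates every projection, in particular one that acts on it as a unit. -/
theorem eq_zero_of_mul_vert_eq_zero
    (hv : ∀ (t : R) (v : V), t • proj R G (G.vert v) = 0 → t = 0)
    {a : LeavittPathAlgebra R G} (ha : a ∈ projSpan R G)
    (h : ∀ v, a * proj R G (G.vert v) = 0) : a = 0 := by
  classical
  obtain ⟨c, rfl⟩ := (Finsupp.mem_span_range_iff_exists_finsupp).1 ha
  -- `p_U` is a local unit for the finitely many `p_C` involved.
  obtain ⟨U, hU⟩ : ∃ U : G.GenVertex, ∀ C ∈ c.support, C.toSet ⊆ U.toSet := by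
    induction c.support using Finset.induction_on with
    | empty => exact ⟨∅, by simp⟩
    | insert D S _ ih =>
      obtain ⟨U, hU⟩ := ih
      refine ⟨D ∪ U, fun C hC => ?_⟩
      rcases Finset.mem_insert.1 hC with rfl | hC
      · exact Set.subset_union_left
      · exact (hU C hC).trans Set.subset_union_right
  have key := sum_smul_proj_mul_sub c.support c 0 U ∅ fun v _ _ => hv _ v <| by
    rw [← h v, Finsupp.sum, Finset.sum_mul, Finset.sum_filter, Finset.sum_smul]
    refine Finset.sum_congr rfl fun C _ => ?_
    rw [smul_mul_assoc]
    split_ifs with hC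
    · rw [proj_mul_vert_of_mem hC]
    · rw [proj_mul_vert_of_notMem hC, zero_smul, smul_zero]
  have hUe : U ∩ ∅ = ∅ := GenVertex.ext' (Set.inter_empty _)
  rw [hUe, proj_empty, sub_zero, zero_smul, Finset.sum_mul] at key
  rw [← key, Finsupp.sum]
  refine Finset.sum_congr rfl fun C hC => ?_
  rw [smul_mul_assoc, proj_mul]
  congr 2
  exact GenVertex.ext' (Set.inter_eq_left.2 (hU C hC)).symm

theorem sum_vert_mul_vert [DecidableEq V] (W : Finset V) (a : LeavittPathAlgebra R G) (v : V) :
    (∑ w ∈ W, a * proj R G (G.vert w)) * proj R G (G.vert v) =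
      if v ∈ W then a * proj R G (G.vert v) else 0 := by
  have : ∀ w ∈ W, a * proj R G (G.vert w) * proj R G (G.vert v) =
      if w = v then a * proj R G (G.vert v) else 0 := by
    intro w _
    rw [mul_assoc]
    split_ifs with h
    · rw [h, proj_mul_vert_of_mem (A := G.vert v) rfl]
    · rw [proj_mul_vert_of_notMem (A := G.vert w) (Ne.symm h), mul_zero]
  rw [Finset.sum_mul, Finset.sum_congr rfl this, Finset.sum_ite_eq']

theorem eq_sum_mul_vert_of_mem_projSpan
    (hv : ∀ (t : R) (v : V), t • proj R G (G.vert v) = 0 → t = 0)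
    {a : LeavittPathAlgebra R G} (ha : a ∈ projSpan R G) (W : Finset V)
    (h : ∀ v ∉ W, a * proj R G (G.vert v) = 0) :
    a = ∑ w ∈ W, a * proj R G (G.vert w) := by
  classical
  refine sub_eq_zero.1 (eq_zero_of_mul_vert_eq_zero hv
    (sub_mem ha (sum_mem fun w _ => mul_proj_mem_projSpan ha _)) fun v => ?_)
  rw [sub_mul, sum_vert_mul_vert]
  split_ifs with hvW
  · exact sub_self _
  · rw [h v hvW, sub_zero]

/-! ### The span of the elements `s_μ p_A` -/

variable (R G) in
/-- The span of the elements `s_μ p_A`. -/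
noncomputable def pathSpan : Submodule R (LeavittPathAlgebra R G) :=
  ⨆ μ : List E, (projSpan R G).map (pathMul R G μ)

theorem pathMul_mem_pathSpan (μ : List E) {a : LeavittPathAlgebra R G}
    (ha : a ∈ projSpan R G) : pathMul R G μ a ∈ pathSpan R G :=
  Submodule.mem_iSup_of_mem μ ⟨a, ha, rfl⟩

theorem exists_of_mem_pathSpan {y : LeavittPathAlgebra R G} (hy : y ∈ pathSpan R G) :
    ∃ (F : Finset (List E)) (a : List E → LeavittPathAlgebra R G),
      (∀ μ, a μ ∈ projSpan R G) ∧ y = ∑ μ ∈ F, pathMul R G μ (a μ) := by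
  obtain ⟨f, hf, rfl⟩ := (Submodule.mem_iSup_iff_exists_finsupp _ _).1 hy
  choose a ha hfa using hf
  exact ⟨f.support, a, ha, Finset.sum_congr rfl fun μ _ => (hfa μ).symm⟩

theorem mul_proj_mem_pathSpan {y : LeavittPathAlgebra R G} (hy : y ∈ pathSpan R G)
    (A : G.GenVertex) : y * proj R G A ∈ pathSpan R G := by
  obtain ⟨F, a, ha, rfl⟩ := exists_of_mem_pathSpan hy
  rw [Finset.sum_mul]
  refine sum_mem fun μ _ => ?_
  rw [pathMul_mul]
  exact pathMul_mem_pathSpan μ (mul_proj_mem_projSpan (ha μ) A)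

theorem mul_edge_mem_pathSpan {y : LeavittPathAlgebra R G} (hy : y ∈ pathSpan R G) (e : E) :
    y * edge R G e ∈ pathSpan R G := by
  obtain ⟨F, a, ha, rfl⟩ := exists_of_mem_pathSpan hy
  rw [Finset.sum_mul]
  refine sum_mem fun μ _ => ?_
  -- Since `s_e = p_{s(e)} s_e`, the coefficient of each path acts on `s_e` as a scalar.
  obtain ⟨t, ht⟩ := exists_mul_vert_eq_smul (ha μ) (G.s e)
  rw [pathMul_mul, ← source_edge, ← mul_assoc, ht, smul_mul_assoc, source_edge, map_smul,
    ← edge_range]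
  refine Submodule.smul_mem _ _ ?_
  rw [← pathMul_nil (proj R G (G.range e)), ← pathMul_cons, ← pathMul_append]
  exact pathMul_mem_pathSpan _ (proj_mem_projSpan _)

/-! ### Combinations of paths modulo the kernel -/

section Kernel

variable {B : Type x} [NonUnitalRing B] [Module R B] {φ : LeavittPathAlgebra R G →ₙₐ[R] B}

theorem pathMul_mul_vert_eq_zero (hL : G.ConditionL)
    (hφ : ∀ (t : R) (v : V), φ (t • proj R G (G.vert v)) = 0 → t = 0)
    {F : Finset (List E)} {a : List E → LeavittPathAlgebra R G} (ha : ∀ μ, a μ ∈ projSpan R G)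
    {v : V} (h : φ ((∑ μ ∈ F, pathMul R G μ (a μ)) * proj R G (G.vert v)) = 0) :
    ∀ μ ∈ F, pathMul R G μ (a μ * proj R G (G.vert v)) = 0 := by
  classical
  choose c hc using fun μ => exists_mul_vert_eq_smul (ha μ) v
  have key := coeff_eq_zero_of_mem_kernel hL hφ (F := F.filter fun μ => G.IsPathTo μ v) (c := c)
    (v := v) (fun μ hμ => (Finset.mem_filter.1 hμ).2) <| by
      rw [← h, Finset.sum_mul, Finset.sum_filter]
      congr 1
      refine Finset.sum_congr rfl fun μ _ => ?_
      rw [pathMul_mul, hc, map_smul]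
      split_ifs with hμ
      · rfl
      · rw [pathMul_vert_of_not_isPathTo hμ, smul_zero]
  intro μ hμ
  rw [hc, map_smul]
  by_cases hp : G.IsPathTo μ v
  · rw [key μ (Finset.mem_filter.2 ⟨hμ, hp⟩), zero_smul]
  · rw [pathMul_vert_of_not_isPathTo hp, smul_zero]

/-- The case `W = ∅` is injectivity on the span of the `s_μ p_A`; general `W` supplies the local
unit `∑ p_w` needed in `eq_zero_of_mul_edge_eq_zero`. Independence separates the paths, and each
coefficient is then treated in the span of the projections. -/
theorem eq_sum_mul_vert_of_mem_pathSpan (hL : G.ConditionL)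
    (hφ : ∀ (t : R) (v : V), φ (t • proj R G (G.vert v)) = 0 → t = 0)
    {y : LeavittPathAlgebra R G} (hy : y ∈ pathSpan R G) (W : Finset V)
    (h : ∀ v ∉ W, φ (y * proj R G (G.vert v)) = 0) :
    y = ∑ w ∈ W, y * proj R G (G.vert w) := by
  have hv : ∀ (t : R) (v : V), t • proj R G (G.vert v) = 0 → t = 0 := fun t v h =>
    hφ t v (by rw [h, map_zero])
  obtain ⟨F, a, ha, rfl⟩ := exists_of_mem_pathSpan hy
  have h' : ∀ μ ∈ F, ∀ v ∉ W, pathMul R G μ (a μ * proj R G (G.vert v)) = 0 :=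
    fun μ hμ v hvW => pathMul_mul_vert_eq_zero hL hφ ha (h v hvW) μ hμ
  simp_rw [Finset.sum_mul]
  rw [Finset.sum_comm]
  refine Finset.sum_congr rfl fun μ hμ => ?_
  simp_rw [pathMul_mul]
  rw [← map_sum]
  rcases μ with _ | ⟨e, μ⟩
  · exact eq_sum_mul_vert_of_mem_projSpan hv (ha _) W (h' _ hμ)
  · rcases pathMul_eq_zero_or_exists (R := R) (G := G) e μ with h₀ | ⟨A, h₁, h₂⟩
    · rw [h₀, h₀]
    -- A path can be cancelled only up to the projection `p_A`, so the coefficient is replaced by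
    -- its product with `p_A`.
    · have := eq_sum_mul_vert_of_mem_projSpan hv (proj_mul_mem_projSpan (ha (e :: μ)) A) W
        fun v hvW => by rw [mul_assoc]; exact h₂ _ (h' _ hμ v hvW)
      rw [← h₁ (a (e :: μ)), this, ← h₁ (∑ w ∈ W, a (e :: μ) * proj R G (G.vert w)),
        Finset.mul_sum]
      simp_rw [mul_assoc]

/-- Write `y p_{s(e)}` as `∑ c_μ s_μ p_{s(e)}`. Multiplying by `s_e p_w` with `w ∈ r(e)` gives `∑
c_μ s_{μe} p_w`; the paths `μe` are distinct, so independence applies. This settles infinite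
emitters below. -/
theorem mul_vert_eq_zero_of_mul_edge (hL : G.ConditionL)
    (hφ : ∀ (t : R) (v : V), φ (t • proj R G (G.vert v)) = 0 → t = 0)
    {y : LeavittPathAlgebra R G} (hy : y ∈ pathSpan R G) {e : E} (h : y * edge R G e = 0) :
    y * proj R G (G.vert (G.s e)) = 0 := by
  classical
  obtain ⟨F, a, ha, rfl⟩ := exists_of_mem_pathSpan hy
  choose c hc using fun μ => exists_mul_vert_eq_smul (ha μ) (G.s e)
  obtain ⟨w, hw⟩ := G.r_nonempty e
  have hinj : Function.Injective fun μ : List E => μ ++ [e] := List.append_left_injective [e]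
  have key := coeff_eq_zero_of_mem_kernel hL hφ
    (F := (F.filter fun μ => G.IsPathTo μ (G.s e)).image (· ++ [e])) (c := fun ν => c ν.dropLast)
    (v := w) (fun ν hν => by
      obtain ⟨μ, hμ, rfl⟩ := Finset.mem_image.1 hν
      exact (Finset.mem_filter.1 hμ).2.concat hw) <| by
      rw [Finset.sum_image hinj.injOn, Finset.sum_filter]
      have h₀ := congrArg (fun x => φ (x * proj R G (G.vert w))) h
      simp only [zero_mul, map_zero] at h₀
      rw [← h₀, Finset.sum_mul, Finset.sum_mul]
      congr 1
      refine Finset.sum_congr rfl fun μ _ => ?_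
      rw [pathMul_mul, pathMul_mul, ← source_edge, ← mul_assoc, hc, smul_mul_assoc,
        smul_mul_assoc, map_smul]
      split_ifs with hμ
      · rw [List.dropLast_concat, pathMul_append, source_edge]
        rfl
      · rw [mul_assoc, ← pathMul_mul, pathMul_vert_of_not_isPathTo hμ, zero_mul, smul_zero]
  rw [Finset.sum_mul]
  refine Finset.sum_eq_zero fun μ hμ => ?_
  rw [pathMul_mul, hc, map_smul]
  by_cases hp : G.IsPathTo μ (G.s e)
  · have := key _ (Finset.mem_image_of_mem _ (Finset.mem_filter.2 ⟨hμ, hp⟩))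
    rw [List.dropLast_concat] at this
    rw [this, zero_smul]
  · rw [pathMul_vert_of_not_isPathTo hp, smul_zero]

end Kernel

end LeavittPathAlgebra

end Ultragraph

namespace Ultragraph

variable {R : Type w} [CommRing R] {V : Type u} {E : Type v} {G : Ultragraph V E}

namespace LeavittPathAlgebra

/-! ### The filtration by the number of ghost edges -/

variable (R G) in
/-- The span of the elements `s_μ p_A s_ν^*` with `ν` of length at most `k`. -/
noncomputable def ghostLevel : ℕ → Submodule R (LeavittPathAlgebra R G)
  | 0 => pathSpan R G
  | k + 1 => pathSpan R G ⊔ ⨆ e : E, (ghostLevel k).map (LinearMap.mulRight R (ghost R G e))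

theorem pathSpan_le_ghostLevel (k : ℕ) : pathSpan R G ≤ ghostLevel R G k := by
  cases k with
  | zero => exact le_rfl
  | succ k => exact le_sup_left

theorem mul_ghost_mem_ghostLevel {k : ℕ} {a : LeavittPathAlgebra R G}
    (ha : a ∈ ghostLevel R G k) (e : E) : a * ghost R G e ∈ ghostLevel R G (k + 1) :=
  Submodule.mem_sup_right (Submodule.mem_iSup_of_mem e ⟨a, ha, rfl⟩)

theorem exists_of_mem_ghostLevel_succ {k : ℕ} {a : LeavittPathAlgebra R G}
    (ha : a ∈ ghostLevel R G (k + 1)) :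
    ∃ y ∈ pathSpan R G, ∃ (F : Finset E) (z : E → LeavittPathAlgebra R G),
      (∀ e, z e ∈ ghostLevel R G k) ∧ a = y + ∑ e ∈ F, z e * ghost R G e := by
  obtain ⟨y, hy, b, hb, rfl⟩ := Submodule.mem_sup.1 ha
  obtain ⟨f, hf, rfl⟩ := (Submodule.mem_iSup_iff_exists_finsupp _ _).1 hb
  choose z hz hfz using hf
  exact ⟨y, hy, f.support, z, hz, congrArg _ (Finset.sum_congr rfl fun e _ => (hfz e).symm)⟩

theorem ghostLevel_le_succ (k : ℕ) : ghostLevel R G k ≤ ghostLevel R G (k + 1) := by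
  induction k with
  | zero => exact pathSpan_le_ghostLevel 1
  | succ k ih =>
    intro a ha
    obtain ⟨y, hy, F, z, hz, rfl⟩ := exists_of_mem_ghostLevel_succ ha
    exact add_mem (pathSpan_le_ghostLevel _ hy)
      (sum_mem fun e _ => mul_ghost_mem_ghostLevel (ih (hz e)) e)

theorem ghostLevel_mono : Monotone (ghostLevel R G) := monotone_nat_of_le_succ ghostLevel_le_succ

theorem mul_proj_mem_ghostLevel {k : ℕ} {a : LeavittPathAlgebra R G}
    (ha : a ∈ ghostLevel R G k) (A : G.GenVertex) : a * proj R G A ∈ ghostLevel R G k := by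
  cases k with
  | zero => exact mul_proj_mem_pathSpan ha A
  | succ k =>
    obtain ⟨y, hy, F, z, hz, rfl⟩ := exists_of_mem_ghostLevel_succ ha
    rw [add_mul, Finset.sum_mul]
    refine add_mem (pathSpan_le_ghostLevel _ (mul_proj_mem_pathSpan hy A)) (sum_mem fun e _ => ?_)
    rw [mul_assoc]
    by_cases h : G.s e ∈ A.toSet
    · rw [ghost_mul_proj_of_mem h]
      exact mul_ghost_mem_ghostLevel (hz e) e
    · rw [ghost_mul_proj_of_notMem h, mul_zero]
      exact zero_mem _

/-- The final ghost edge cancels against `s_e` by `s_f^* s_e = δ_{f,e} p_{r(e)}`, while the span of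
the `s_μ p_A` absorbs edges on the right. -/
theorem mul_edge_mem_ghostLevel {k : ℕ} {a : LeavittPathAlgebra R G}
    (ha : a ∈ ghostLevel R G (k + 1)) (e : E) : a * edge R G e ∈ ghostLevel R G k := by
  obtain ⟨y, hy, F, z, hz, rfl⟩ := exists_of_mem_ghostLevel_succ ha
  rw [add_mul, Finset.sum_mul]
  refine add_mem (pathSpan_le_ghostLevel _ (mul_edge_mem_pathSpan hy e)) (sum_mem fun f _ => ?_)
  rw [mul_assoc]
  by_cases h : f = e
  · rw [h, ghost_edge_same]
    exact mul_proj_mem_ghostLevel (hz e) _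
  · rw [ghost_edge_ne h, mul_zero]
    exact zero_mem _

variable (R G) in
/-- The union of the filtration. -/
noncomputable def ghostUnion : Submodule R (LeavittPathAlgebra R G) := ⨆ k, ghostLevel R G k

theorem mem_ghostUnion {a : LeavittPathAlgebra R G} :
    a ∈ ghostUnion R G ↔ ∃ k, a ∈ ghostLevel R G k :=
  Submodule.mem_iSup_of_directed _ ghostLevel_mono.directed_le

theorem mk_gen_mem_ghostUnion (g : G.Gen) : mk R G (FreeAlg.gen R G g) ∈ ghostUnion R G := by
  rw [mem_ghostUnion]
  cases g with
  | edge e =>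
    refine ⟨0, ?_⟩
    change edge R G e ∈ pathSpan R G
    rw [← source_edge]
    exact mul_edge_mem_pathSpan (pathMul_mem_pathSpan [] (proj_mem_projSpan _)) e
  | ghost e =>
    refine ⟨1, ?_⟩
    change ghost R G e ∈ ghostLevel R G (0 + 1)
    rw [← range_ghost]
    exact mul_ghost_mem_ghostLevel (pathMul_mem_pathSpan [] (proj_mem_projSpan _)) e
  | proj A => exact ⟨0, pathMul_mem_pathSpan [] (proj_mem_projSpan A)⟩

theorem mul_mk_gen_mem_ghostUnion {a : LeavittPathAlgebra R G} (ha : a ∈ ghostUnion R G)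
    (g : G.Gen) : a * mk R G (FreeAlg.gen R G g) ∈ ghostUnion R G := by
  rw [mem_ghostUnion] at ha ⊢
  obtain ⟨k, hk⟩ := ha
  cases g with
  | edge e => exact ⟨k, mul_edge_mem_ghostLevel (ghostLevel_le_succ k hk) e⟩
  | ghost e => exact ⟨k + 1, mul_ghost_mem_ghostLevel hk e⟩
  | proj A => exact ⟨k, mul_proj_mem_ghostLevel hk A⟩

theorem exists_mem_ghostLevel (a : LeavittPathAlgebra R G) : ∃ k, a ∈ ghostLevel R G k := by
  -- Words are split at their first letter, so the induction must also carry stability under right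
  -- multiplication by the word.
  have word : ∀ m : FreeSemigroup G.Gen,
      mk R G (MonoidAlgebra.single m 1) ∈ ghostUnion R G ∧
        ∀ b ∈ ghostUnion R G, b * mk R G (MonoidAlgebra.single m 1) ∈ ghostUnion R G := by
    intro m
    induction m using FreeSemigroup.recOnMul with
    | ih1 g => exact ⟨mk_gen_mem_ghostUnion g, fun b hb => mul_mk_gen_mem_ghostUnion hb g⟩
    | ih2 g m hg hm =>
      have : (MonoidAlgebra.single (FreeSemigroup.of g * m) 1 : G.FreeAlg R) =
          MonoidAlgebra.single (FreeSemigroup.of g) 1 * MonoidAlgebra.single m 1 := by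
        rw [MonoidAlgebra.single_mul_single, one_mul]
      rw [this, mk_mul]
      refine ⟨hm.2 _ hg.1, fun b hb => ?_⟩
      rw [← mul_assoc]
      exact hm.2 _ (hg.2 b hb)
  rw [← mem_ghostUnion]
  obtain ⟨a, rfl⟩ := mk_surjective R G a
  induction a using MonoidAlgebra.induction_linear with
  | zero => exact zero_mem _
  | add a b iha ihb => exact add_mem iha ihb
  | single m t =>
    have : (MonoidAlgebra.single m t : G.FreeAlg R) = t • MonoidAlgebra.single m 1 := by
      rw [MonoidAlgebra.smul_single, smul_eq_mul, mul_one]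
    rw [this, mk_smul]
    exact Submodule.smul_mem _ t (word m).1

/-! ### The uniqueness theorem -/

variable {B : Type x} [NonUnitalRing B] [Module R B] {φ : LeavittPathAlgebra R G →ₙₐ[R] B}

theorem eq_zero_of_mem_pathSpan (hL : G.ConditionL)
    (hφ : ∀ (t : R) (v : V), φ (t • proj R G (G.vert v)) = 0 → t = 0)
    {y : LeavittPathAlgebra R G} (hy : y ∈ pathSpan R G) (h : φ y = 0) : y = 0 := by
  have := eq_sum_mul_vert_of_mem_pathSpan hL hφ hy ∅ fun v _ => by rw [map_mul, h, zero_mul]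
  rwa [Finset.sum_empty] at this

/-- The hypothesis determines the ghost terms: `a = y - ∑_{e ∈ F} y s_e s_e^*`. From this `a p_v =
0` follows for every vertex, and `a` is a finite sum of elements `a p_w`. -/
theorem eq_zero_of_mul_edge_eq_zero (hL : G.ConditionL)
    (hφ : ∀ (t : R) (v : V), φ (t • proj R G (G.vert v)) = 0 → t = 0)
    {a y : LeavittPathAlgebra R G} (hy : y ∈ pathSpan R G) {F : Finset E}
    {z : E → LeavittPathAlgebra R G} (haz : a = y + ∑ e ∈ F, z e * ghost R G e) (ha : φ a = 0)
    (h : ∀ e, a * edge R G e = 0) : a = 0 := by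
  classical
  have edge_mem : ∀ e ∈ F, z e * ghost R G e = -(y * (edge R G e * ghost R G e)) := by
    intro e he
    have h₁ := h e
    rw [haz, add_mul, Finset.sum_mul, Finset.sum_eq_single_of_mem e he, mul_assoc,
      ghost_edge_same] at h₁
    · rw [← range_ghost, ← mul_assoc, eq_neg_of_add_eq_zero_right h₁, neg_mul, range_ghost,
        mul_assoc]
    · intro f _ hfe
      rw [mul_assoc, ghost_edge_ne hfe, mul_zero]
  have edge_notMem : ∀ e ∉ F, y * edge R G e = 0 := by
    intro e he
    have h₁ := h e
    rwa [haz, add_mul, Finset.sum_mul, Finset.sum_eq_zero, add_zero] at h₁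
    intro f hf
    rw [mul_assoc, ghost_edge_ne (fun hfe : f = e => he (hfe ▸ hf)), mul_zero]
  have eq_sub : a = y - ∑ e ∈ F, y * (edge R G e * ghost R G e) := by
    rw [haz, sub_eq_add_neg, ← Finset.sum_neg_distrib, Finset.sum_congr rfl edge_mem]
  have mul_vert_of : ∀ v, (∀ e ∈ F, G.s e = v → y * edge R G e = 0) →
      a * proj R G (G.vert v) = y * proj R G (G.vert v) := by
    intro v hv
    rw [eq_sub, sub_mul, Finset.sum_mul, Finset.sum_eq_zero, sub_zero]
    intro e he
    by_cases hev : G.s e = v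
    · rw [← mul_assoc, hv e he hev, zero_mul, zero_mul]
    · rw [mul_assoc, mul_assoc, ghost_mul_proj_of_notMem (A := G.vert v) hev, mul_zero, mul_zero]
  have mul_vert : ∀ v, a * proj R G (G.vert v) = 0 := by
    intro v
    -- For a regular vertex, expand `p_v = ∑ s_e s_e^*`. An infinite emitter has an edge outside
    -- `F`, which forces `y p_v = 0`. At a sink `a p_v = y p_v` has no ghost edges, so the base case
    -- applies.
    by_cases hne : {e | G.s e = v}.Nonempty
    · by_cases hfin : {e | G.s e = v}.Finite
      · rw [vertex v hfin hne, Finset.mul_sum]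
        refine Finset.sum_eq_zero fun e _ => ?_
        rw [← mul_assoc, h e, zero_mul]
      · obtain ⟨e, rfl, he⟩ := Set.Infinite.exists_notMem_finset hfin F
        have hyv := mul_vert_eq_zero_of_mul_edge hL hφ hy (edge_notMem e he)
        rw [mul_vert_of, hyv]
        intro f _ hf
        rw [← source_edge, hf, ← mul_assoc, hyv, zero_mul]
    · have hyv := mul_vert_of v fun e _ hev => absurd ⟨e, hev⟩ hne
      rw [hyv]
      refine eq_zero_of_mem_pathSpan hL hφ (mul_proj_mem_pathSpan hy _) ?_
      rw [← hyv, map_mul, ha, zero_mul]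
  -- Away from the sources of `F` there are no ghost terms, so `y p_v = a p_v = 0` there.
  have hyW := eq_sum_mul_vert_of_mem_pathSpan hL hφ hy (F.image G.s) fun v hv => by
    rw [← mul_vert_of v fun e he hev => absurd (Finset.mem_image.2 ⟨e, he, hev⟩) hv, mul_vert,
      map_zero]
  have haW : a = ∑ w ∈ F.image G.s, a * proj R G (G.vert w) := by
    have hg : ∀ e ∈ F, ∑ w ∈ F.image G.s, ghost R G e * proj R G (G.vert w) = ghost R G e := by
      intro e he
      rw [Finset.sum_eq_single_of_mem _ (Finset.mem_image_of_mem _ he), ghost_source]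
      intro w _ hw
      exact ghost_mul_proj_of_notMem (A := G.vert w) (Ne.symm hw)
    rw [haz]
    simp_rw [add_mul]
    rw [Finset.sum_add_distrib, ← hyW]
    simp_rw [Finset.sum_mul]
    rw [Finset.sum_comm]
    congr 1
    refine Finset.sum_congr rfl fun e he => ?_
    simp_rw [mul_assoc]
    rw [← Finset.mul_sum, hg e he]
  rw [haW]
  exact Finset.sum_eq_zero fun w _ => mul_vert w

/-- The Cuntz–Krieger uniqueness theorem: under Condition (L), a homomorphism on `L_R(G)` is
injective if it does not annihilate any nonzero multiple of a vertex projection. -/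
theorem injective_of_conditionL (hL : G.ConditionL)
    (hφ : ∀ (t : R) (v : V), φ (t • proj R G (G.vert v)) = 0 → t = 0) :
    Function.Injective φ := by
  rw [injective_iff_map_eq_zero]
  intro a ha
  obtain ⟨k, hk⟩ := exists_mem_ghostLevel a
  induction k generalizing a with
  | zero => exact eq_zero_of_mem_pathSpan hL hφ hk ha
  | succ k ih =>
    obtain ⟨y, hy, F, z, -, haz⟩ := exists_of_mem_ghostLevel_succ hk
    refine eq_zero_of_mul_edge_eq_zero hL hφ hy haz ha fun e => ih _ ?_ ?_
    · rw [map_mul, ha, zero_mul]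
    · exact mul_edge_mem_ghostLevel hk e

end LeavittPathAlgebra

end Ultragraph

namespace Ultragraph

variable (R : Type w) [CommRing R] {V : Type u} {E : Type v} {G : Ultragraph V E}

/-! ### Operators of branching systems and a separation by degree -/

namespace BranchingSystem

variable {X : Type x} (B : G.BranchingSystem X)

open LeavittPathAlgebra

open scoped Classical in
theorem rep_proj_apply (A : G.GenVertex) (g : X → R) (z : X) :
    B.rep R (proj R G A) g z = if z ∈ B.D A then g z else 0 := by
  rw [rep_proj]; rfl

open scoped Classical in
theorem rep_edge_mul_apply (e : E) (a : LeavittPathAlgebra R G) (g : X → R) (z : X) :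
    B.rep R (edge R G e * a) g z =
      if h : z ∈ B.R e then B.rep R a g ((B.f e).symm ⟨z, h⟩) else 0 := by
  rw [map_mul, rep_edge]; rfl

theorem eq_zero_of_rep_smul_proj {A : G.GenVertex} (hA : (B.D A).Nonempty) {t : R}
    (h : B.rep R (t • proj R G A) = 0) : t = 0 := by
  obtain ⟨z, hz⟩ := hA
  have := congrFun (LinearMap.congr_fun h fun _ => 1) z
  rw [map_smul, LinearMap.smul_apply, Pi.smul_apply, rep_proj_apply, if_pos hz] at this
  simpa using this

/-- The branching system on `X × ℤ` in which every `f_e` raises the second coordinate by one. -/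
def shift : G.BranchingSystem (X × ℤ) where
  R e := {z | z.1 ∈ B.R e}
  D A := {z | z.1 ∈ B.D A}
  f e :=
    { toFun z := ⟨(B.f e ⟨z.1.1, z.2⟩, z.1.2 + 1), (B.f e ⟨z.1.1, z.2⟩).2⟩
      invFun z := ⟨((B.f e).symm ⟨z.1.1, z.2⟩, z.1.2 - 1), ((B.f e).symm ⟨z.1.1, z.2⟩).2⟩
      left_inv z := by simp
      right_inv z := by simp }
  R_disjoint e e' h := by
    have := B.R_disjoint e e' h
    ext z
    exact Set.ext_iff.1 this z.1
  D_empty := by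
    ext z
    exact Set.ext_iff.1 B.D_empty z.1
  D_inter A A' := by
    ext z
    exact Set.ext_iff.1 (B.D_inter A A') z.1
  D_union A A' := by
    ext z
    exact Set.ext_iff.1 (B.D_union A A') z.1
  R_subset e z hz := B.R_subset e hz
  D_vert v hfin hne := by
    ext z
    have := Set.ext_iff.1 (B.D_vert v hfin hne) z.1
    simpa using this

/-- Each edge of `μ` raises the height by one, so the value at height `j` draws only on `g` at
height `j - μ.length`. -/
theorem rep_shift_pathMul_apply_eq_zero (A : G.GenVertex) (g : X × ℤ → R) (μ : List E) (z : X)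
    (j : ℤ) (hg : ∀ z', g (z', j - μ.length) = 0) :
    B.shift.rep R (pathMul R G μ (proj R G A)) g (z, j) = 0 := by
  classical
  induction μ generalizing z j with
  | nil =>
    rw [pathMul_nil, rep_proj_apply]
    have := hg z
    simp only [List.length_nil, Nat.cast_zero, sub_zero] at this
    rw [this, ite_self]
  | cons e μ ih =>
    rw [pathMul_cons, rep_edge_mul_apply]
    split_ifs with h
    · refine ih _ (j - 1) fun z' => ?_
      rw [← hg z']
      congr 2
      push_cast [List.length_cons]
      ring
    · rfl

/-- In the shifted system `p_v` preserves height, while `s_μ p_v` raises it by `μ.length > 0`. The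
indicator of height zero tells them apart. -/
theorem pathMul_ne_vert [Nontrivial R] {v : V} (hv : (B.D (G.vert v)).Nonempty) {μ : List E}
    (hμ : μ ≠ []) : pathMul R G μ (proj R G (G.vert v)) ≠ proj R G (G.vert v) := by
  classical
  intro h
  obtain ⟨z, hz⟩ := hv
  let g : X × ℤ → R := fun y => if y.2 = 0 then 1 else 0
  have h₁ := B.rep_shift_pathMul_apply_eq_zero R (G.vert v) g μ z 0 fun z' => by
    simp [g, hμ]
  rw [h, rep_proj_apply, if_pos (show (z, (0 : ℤ)) ∈ B.shift.D (G.vert v) from hz)] at h₁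
  simp [g] at h₁

end BranchingSystem

/-! ### The branching system of maximal paths -/

variable (G)

/-- A vertex at which a path may end: a sink or an infinite emitter. -/
def IsSingular (v : V) : Prop := {e | G.s e = v}.Finite → ¬ {e | G.s e = v}.Nonempty

/-- A maximal path, written as a sequence of edges that is either infinite or eventually constant
at a singular vertex. -/
structure MaximalPath : Type (max u v x) where
  /-- The edges of the path, followed by its end point if there is one. -/
  seq : ℕ → E ⊕ V
  /-- Each edge is followed by an edge or an end point in its range. -/
  step : ∀ n e, seq n = .inl e → Sum.elim G.s id (seq (n + 1)) ∈ G.r e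
  /-- A path ends at singular vertices only. -/
  stationary : ∀ n v, seq n = .inr v → G.IsSingular v ∧ seq (n + 1) = .inr v

variable {G}

namespace MaximalPath

@[ext] theorem ext {p q : MaximalPath.{u, v, x} G} (h : p.seq = q.seq) : p = q := by
  cases p; cases q; cases h; rfl

/-- The source of a maximal path. -/
def source (p : MaximalPath.{u, v, x} G) : V := Sum.elim G.s id (p.seq 0)

/-- The maximal path with its first edge removed. -/
def tail (p : MaximalPath.{u, v, x} G) : MaximalPath.{u, v, x} G where
  seq n := p.seq (n + 1)
  step n := p.step (n + 1)
  stationary n := p.stationary (n + 1)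

/-- The maximal path with an edge added at the front. -/
def cons (e : E) (p : MaximalPath.{u, v, x} G) (h : p.source ∈ G.r e) :
    MaximalPath.{u, v, x} G where
  seq n := Nat.casesOn n (.inl e) p.seq
  step n f hf := by
    cases n with
    | zero => cases hf; exact h
    | succ n => exact p.step n f hf
  stationary n v hv := by
    cases n with
    | zero => cases hv
    | succ n => exact p.stationary n v hv

variable (G) in
/-- The maximal path that takes a chosen edge at each regular vertex. -/
theorem exists_source_eq (v : V) : ∃ p : MaximalPath.{u, v, x} G, p.source = v := by
  classical
  choose next hnext using G.r_nonempty
  -- Emit a chosen edge at a regular vertex and stop at a singular one.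
  let start : V → E ⊕ V := fun v =>
    if h : {e | G.s e = v}.Nonempty ∧ {e | G.s e = v}.Finite then .inl h.1.some else .inr v
  have elim_start : ∀ v, Sum.elim G.s id (start v) = v := by
    intro v
    by_cases h : {e | G.s e = v}.Nonempty ∧ {e | G.s e = v}.Finite
    · simp only [start, dif_pos h]
      exact h.1.some_mem
    · simp [start, dif_neg h]
  have start_inr : ∀ v w, start v = .inr w → w = v ∧ G.IsSingular v := by
    intro v w hvw
    by_cases h : {e | G.s e = v}.Nonempty ∧ {e | G.s e = v}.Finite
    · simp [start, dif_pos h] at hvw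
    · simp only [start, dif_neg h] at hvw
      exact ⟨(Sum.inr.inj hvw).symm, fun hf hn => h ⟨hn, hf⟩⟩
  let seq : ℕ → E ⊕ V := fun n =>
    Nat.rec (start v) (fun _ => Sum.elim (fun e => start (next e)) .inr) n
  have seq_succ : ∀ n, seq (n + 1) = Sum.elim (fun e => start (next e)) .inr (seq n) :=
    fun n => rfl
  have singular_of_seq : ∀ n w, seq n = .inr w → G.IsSingular w := by
    intro n
    induction n with
    | zero =>
      intro w hw
      obtain ⟨rfl, h⟩ := start_inr v w hw
      exact h
    | succ n ih =>
      intro w hw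
      rw [seq_succ] at hw
      rcases hn : seq n with e | w'
      · rw [hn] at hw
        obtain ⟨rfl, h⟩ := start_inr _ w hw
        exact h
      · rw [hn] at hw
        obtain rfl : w' = w := Sum.inr.inj hw
        exact ih _ hn
  refine ⟨⟨seq, fun n e he => ?_, fun n w hw => ⟨singular_of_seq n w hw, ?_⟩⟩, elim_start v⟩
  · rw [seq_succ, he, Sum.elim_inl, elim_start]
    exact hnext e
  · rw [seq_succ, hw, Sum.elim_inr]

variable (G) in
/-- The branching system on the set of all maximal paths. -/
def branchingSystem : G.BranchingSystem (MaximalPath.{u, v, x} G) where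
  R e := {p | p.seq 0 = .inl e}
  D A := {p | p.source ∈ A.toSet}
  f e :=
    { toFun p := ⟨cons e p.1 p.2, rfl⟩
      invFun p := ⟨p.1.tail, p.1.step 0 e p.2⟩
      left_inv p := rfl
      right_inv p := by
        refine Subtype.ext (MaximalPath.ext (funext fun n => ?_))
        cases n with
        | zero => exact p.2.symm
        | succ n => rfl }
  R_disjoint e e' h := by
    ext p
    simp only [Set.mem_inter_iff, Set.mem_ofPred_eq, Set.mem_empty_iff_false, iff_false, not_and]
    intro h₁ h₂
    exact h (Sum.inl.inj (h₁.symm.trans h₂))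
  D_empty := rfl
  D_inter _ _ := rfl
  D_union _ _ := rfl
  R_subset e p hp := by
    have hp' : p.seq 0 = .inl e := hp
    simp [source, hp']
  D_vert v hfin hne := by
    ext p
    simp only [Set.mem_ofPred_eq, toSet_vert, Set.mem_singleton_iff, Set.mem_iUnion, exists_prop]
    rcases h : p.seq 0 with e | w
    · simp [source, h, eq_comm]
    · simp only [source, h, Sum.elim_inr, id_eq, reduceCtorEq, and_false, exists_false, iff_false]
      rintro rfl
      exact (p.stationary 0 w h).1 hfin hne

theorem branchingSystem_D_nonempty (A : G.GenVertex) (hA : A.toSet.Nonempty) :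
    ((branchingSystem.{u, v, x} G).D A).Nonempty := by
  obtain ⟨v, hv⟩ := hA
  obtain ⟨p, rfl⟩ := exists_source_eq.{u, v, x} G v
  exact ⟨p, hv⟩

end MaximalPath

/-! ### Closed paths without exits -/

open LeavittPathAlgebra MaximalPath

/-- The sequence `a` is a closed path without exit, unrolled. Each vertex it visits emits exactly
one edge, so it is regular: a maximal path can neither stop there nor branch. -/
theorem seq_eq_of_forced {a : ℕ → E}
    (ha : ∀ k, ∀ w ∈ G.r (a k), w = G.s (a (k + 1)))
    (hs : ∀ k e, G.s e = G.s (a k) → e = a k) {k : ℕ} {p : MaximalPath.{u, v, x} G}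
    (hp : p.source = G.s (a k)) : ∀ n, p.seq n = .inl (a (k + n)) := by
  have aux : ∀ n, Sum.elim G.s id (p.seq n) = G.s (a (k + n)) → p.seq n = .inl (a (k + n)) := by
    intro n hn
    rcases h : p.seq n with e | w
    · rw [h] at hn
      rw [hs _ e hn]
    · rw [h] at hn
      obtain rfl : w = G.s (a (k + n)) := hn
      have hset : {e | G.s e = G.s (a (k + n))} = {a (k + n)} :=
        Set.ext fun e => ⟨hs _ e, fun h => congrArg G.s h⟩
      refine absurd ?_ ((p.stationary n _ h).1 ?_)
      · exact ⟨a (k + n), rfl⟩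
      · rw [hset]; exact Set.finite_singleton _
  intro n
  induction n with
  | zero => exact aux 0 hp
  | succ n ih => exact aux (n + 1) (ha _ _ (p.step n _ ih))

/-- Only one maximal path starts at `s(a_k)`. Removing its first `m` edges gives `q`, where the
operator evaluates `g`. -/
theorem rep_pathMul_forced {a : ℕ → E}
    (ha : ∀ k, ∀ w ∈ G.r (a k), w = G.s (a (k + 1)))
    (hs : ∀ k e, G.s e = G.s (a k) → e = a k) (g : MaximalPath.{u, v, x} G → R) (m k : ℕ)
    (p : MaximalPath.{u, v, x} G) (q : MaximalPath.{u, v, x} G)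
    (hq : ∀ n, q.seq n = .inl (a (k + m + n))) [Decidable (p.source = G.s (a k))] :
    (branchingSystem G).rep R
        (pathMul R G ((List.range' k m).map a) (proj R G (G.vert (G.s (a (k + m)))))) g p =
      if p.source = G.s (a k) then g q else 0 := by
  classical
  induction m generalizing k p with
  | zero =>
    rw [List.range'_zero, List.map_nil, pathMul_nil, BranchingSystem.rep_proj_apply,
      Nat.add_zero]
    by_cases hp : p.source = G.s (a k)
    · have : p = q := MaximalPath.ext <| funext fun n => by
        rw [hq, seq_eq_of_forced ha hs hp]; rfl
      rw [if_pos hp, if_pos (show p ∈ (branchingSystem G).D (G.vert (G.s (a k))) from hp), this]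
    · rw [if_neg hp, if_neg (show p ∉ (branchingSystem G).D (G.vert (G.s (a k))) from hp)]
  | succ m ih =>
    rw [List.range'_succ, List.map_cons, pathMul_cons, BranchingSystem.rep_edge_mul_apply]
    have hkm : k + (m + 1) = k + 1 + m := by ring
    by_cases hp : p.source = G.s (a k)
    · have hR : p.seq 0 = .inl (a k) := seq_eq_of_forced ha hs hp 0
      rw [dif_pos (show p ∈ (branchingSystem G).R (a k) from hR), if_pos hp, hkm,
        ih (k + 1) _ fun n => by rw [hq, hkm]]
      rw [if_pos]
      exact ha k _ (p.step 0 _ hR)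
    · rw [if_neg hp, dif_neg]
      intro hR
      have hR' : p.seq 0 = .inl (a k) := hR
      exact hp (by simp [MaximalPath.source, hR'])

/-- After a full period the remaining path `q` is again the path at `s(a_0)`, so the loop acts as
its vertex projection, although the two elements differ by `pathMul_ne_vert`. -/
theorem not_injective_rep_of_forced [Nontrivial R] {a : ℕ → E} {n : ℕ}
    (ha : ∀ k, ∀ w ∈ G.r (a k), w = G.s (a (k + 1)))
    (hs : ∀ k e, G.s e = G.s (a k) → e = a k) (hn : ∀ k, a (k + (n + 1)) = a k) :
    ¬ Function.Injective ((branchingSystem.{u, v, x} G).rep R) := by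
  classical
  intro hinj
  refine (branchingSystem.{u, v, x} G).pathMul_ne_vert R (v := G.s (a 0))
    (branchingSystem_D_nonempty _ (Set.singleton_nonempty _))
    (μ := (List.range' 0 (n + 1)).map a) (by simp) (hinj ?_)
  refine LinearMap.ext fun g => funext fun p => ?_
  obtain ⟨q, hq⟩ := exists_source_eq.{u, v, x} G (G.s (a 0))
  have hq' := seq_eq_of_forced ha hs hq
  have h := rep_pathMul_forced R ha hs g (n + 1) 0 p q fun m => by
    rw [hq', ← hn]; congr 2; ring
  rw [hn 0] at h
  rw [h, BranchingSystem.rep_proj_apply]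
  by_cases hp : p.source = G.s (a 0)
  · have : p = q := MaximalPath.ext <| funext fun m => by
      rw [hq', seq_eq_of_forced ha hs hp]
    rw [if_pos hp, this, if_pos]
    exact hq
  · rw [if_neg hp, if_neg]
    exact hp

/-- If Condition (L) fails, then the representation on maximal paths is not faithful. -/
theorem conditionL_of_injective_rep [Nontrivial R]
    (h : Function.Injective ((branchingSystem.{u, v, x} G).rep R)) : G.ConditionL := by
  intro n α hα
  by_contra hexit
  have hedge : ∀ e i, G.s e ∈ G.r (α i) → e = α (i + 1) := fun e i he => by
    by_contra hne
    exact hexit (.inl ⟨e, i, he, hne⟩)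
  -- A vertex of the range is not a sink, so it emits an edge, which can only be the next edge of
  -- the path.
  have hsink : ∀ i, ∀ w ∈ G.r (α i), w = G.s (α (i + 1)) := fun i w hw => by
    by_contra hne
    refine hexit (.inr ⟨w, fun e he => hne ?_, i, hw⟩)
    rw [← he] at hw
    rw [← hedge e i hw, he]
  have hmem : ∀ i, G.s (α (i + 1)) ∈ G.r (α i) := fun i => by
    obtain ⟨w, hw⟩ := G.r_nonempty (α i)
    rwa [← hsink i w hw]
  have hsucc : ∀ k, Fin.ofNat (n + 1) (k + 1) = Fin.ofNat (n + 1) k + 1 := fun k => by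
    ext
    simp [Fin.val_add]
  refine not_injective_rep_of_forced R (a := fun k => α (Fin.ofNat (n + 1) k)) (n := n)
    (fun k w hw => ?_) (fun k e he => ?_) (fun k => ?_) h
  · rw [hsucc]
    exact hsink _ w hw
  -- Uniqueness of the edge at a vertex is known only for vertices in the range of a path edge, so
  -- the index is written as the cyclic successor of its predecessor.
  · have hk : Fin.ofNat (n + 1) k = Fin.ofNat (n + 1) k - 1 + 1 := (sub_add_cancel _ _).symm
    rw [hk]
    refine hedge e _ ?_
    rw [he]
    rw [hk, add_sub_cancel_right]
    exact hmem _
  · congr 1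
    ext
    simp

end Ultragraph

/-! ### The equivalence -/

theorem mainTheorem4 {V : Type u} {E : Type v} (G : Ultragraph V E)
    (R : Type w) [CommRing R] [Nontrivial R]
    (hs : ∀ v : V, {e : E | G.s e = v}.Countable)
    (hr : ∀ e : E, (G.r e).Countable) :
    G.ConditionL ↔
      ∀ (X : Type (max u v x)) (B : G.BranchingSystem X),
        (∀ A : G.GenVertex, A.toSet.Nonempty → (B.D A).Nonempty) →
          Function.Injective (B.rep R) := by
  constructor
  · intro hL X B hB
    refine Ultragraph.LeavittPathAlgebra.injective_of_conditionL hL fun t v h => ?_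
    exact B.eq_zero_of_rep_smul_proj R (hB (G.vert v) (Set.singleton_nonempty v)) h
  · intro h
    exact Ultragraph.conditionL_of_injective_rep.{u, v, w, x} R
      (h _ (Ultragraph.MaximalPath.branchingSystem.{u, v, x} G)
        Ultragraph.MaximalPath.branchingSystem_D_nonempty)
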